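/- **Setting.** Let $\mathcal X$ be a measurable space, $\mathcal Y=\{-1,1\}$, and let $\mathcal H$ be a class of measurable functions $\mathcal X\to\mathcal Y$ of finite VC dimension $d$. For a probability measure $\mathcal D$ on $\mathcal X\times\mathcal Y$ and measurable $h:\mathcal X\to\mathcal Y$ let $\mathcal L_{\mathcal D}(h)=\Pr_{(x,y)\sim\mathcal D}[h(x)\neq y]$ and $\tau=\inf_{h\in\mathcal H}\mathcal L_{\mathcal D}(h)$. Let $\mathcal A$ be an ERM learner for $\mathcal H$: for every finite training sequence $S$, $\mathcal A(S)\in\mathcal H$ minimizes the number of errors on $S$ over $\mathcal H$. The map $(S,x)\mapsto\mathcal A(S)(x)$ is assumed measurable on $(\mathcal X\times\mathcal Y)^n\times\mathcal X$ for each $n$. **Splitting.** For sequences $S,T$ with $|S|=3^k$ define a finite family (with multiplicity) $\mathcal S(S;T)$ of sequences as follows ($\sqcup$ is concatenation). If $k<6$, its only member is $S\sqcup T$. If $k\ge 6$, cut $S$ into $27$ consecutive blocks $S_1,\dots,S_{27}$ of length $3^{k-3}$, let $S_{i,\sqcup}$ be the first $3^{k-6}$ entries of $S_i$ and $S_{i,\sqcap}$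 the remaining ones, and let $\mathcal S(S;T)$ be the union with multiplicity of the families $\mathcal S(S_{i,\sqcup};S_{i,\sqcap}\sqcup T)$, $i=1,\dots,27$. **Voters.** For $t\in\mathbb N$ let $\widehat{\mathcal A}_{\mathbf t}(S)$ be the multiset of the $t$ classifiers $\mathcal A(S'_1),\dots,\mathcal A(S'_t)$, where $S'_1,\dots,S'_t$ are drawn independently and uniformly with replacement from $\mathcal S(S;\emptyset)$; $\mathbf t$ denotes the randomness of these draws. **Tie-breaking.** Let $m=3^k$ and split $\mathbf S\sim\mathcal D^m$ into three consecutive parts $\mathbf S_1,\mathbf S_2,\mathbf S_3$ of length $m/3$. Draw $\widehat{\mathcal A}_{\mathbf t_1}(\mathbf S_1)$ ($t_1$ voters) and $\widehat{\mathcal A}_{\mathbf t_2}(\mathbf S_2)$ ($t_2$ voters) with independent randomness $\mathbf t_1,\mathbf t_2$. Let $\mathbf S_3^{\neq}$ be the subsequence of those $(x,y)$ in $\mathbf S_3$ on which at least an $11/243$ fraction of the voters in $\widehat{\mathcal A}_{\mathbf t_1}(\mathbf S_1)$, or at least an $11/243$ fraction of those in $\widehat{\mathcal A}_{\mathbf t_2}(\mathbf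 S_2)$, predict a label different from $y$, and let $h_{\mathrm{tie}}=\mathcal A(\mathbf S_3^{\neq})$. Let $\mathrm{Tie}^{11/243}(x)$ be the label $y$ if at least a $232/243$ fraction of the voters in $\widehat{\mathcal A}_{\mathbf t_1}(\mathbf S_1)$ and at least a $232/243$ fraction of those in $\widehat{\mathcal A}_{\mathbf t_2}(\mathbf S_2)$ predict $y$ at $x$; if there is no such label, let it be $h_{\mathrm{tie}}(x)$. **Theorem.** There is a universal constant $c\ge 1$ such that for all $\mathcal X$, $\mathcal H$, $d$, $\mathcal A$, $\mathcal D$ as above, every $0<\delta<1$, every $m=3^k$ with $k\ge5$, and all natural numbers $$t_1,t_2\ \ge\ 4\cdot 243^2\,\ln\!\left(\frac{2m}{\delta\,(d+\ln(86/\delta))}\right),$$ with probability at least $1-\delta$ over $\mathbf S\sim\mathcal D^m$ and the draws $\mathbf t_1,\mathbf t_2$, $$\mathcal L_{\mathcal D}\big(\mathrm{Tie}^{11/243}\big)\ \le\ 2.0888\,\tau+\sqrt{\frac{c\,\tau\,(d+\ln(e/\delta))}{m}}+\frac{c\,(d+\ln(e/\delta))}{m}.$$ -/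

import Mathlib

open MeasureTheory

namespace TieLearn

/-- A labelled example. `Bool` plays the role of the two-element label set `{-1, 1}`. -/
abbrev Example (X : Type*) := X × Bool

/-- A learner maps finite training sequences to classifiers. -/
abbrev Learner (X : Type*) := List (Example X) → X → Bool

/-- `H` shatters the finite set `C`: every labelling of `C` is realised by some `h ∈ H`. -/
def Shatters {X : Type*} (H : Set (X → Bool)) (C : Finset X) : Prop :=
  ∀ f : X → Bool, ∃ h ∈ H, ∀ x ∈ C, h x = f x

/-- `H` has (finite) VC dimension `d`: the largest cardinality of a shattered set is `d`. -/
def HasVCDim {X : Type*} (H : Set (X → Bool)) (d : ℕ) : Prop :=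
  IsGreatest {n : ℕ | ∃ C : Finset X, C.card = n ∧ Shatters H C} d

/-- Empirical 0-1 error of `h` on the sequence `S` (equal to `0` on the empty sequence). -/
noncomputable def empErr {X : Type*} (S : List (Example X)) (h : X → Bool) : ℝ :=
  (S.countP (fun z => h z.1 != z.2) : ℝ) / (S.length : ℝ)

/-- `A` is a (proper) empirical risk minimizer for `H`. -/
def IsERM {X : Type*} (H : Set (X → Bool)) (A : Learner X) : Prop :=
  ∀ S : List (Example X), A S ∈ H ∧ ∀ h ∈ H, empErr S (A S) ≤ empErr S h

/-- The prediction of the learner depends measurably on the training sequence and the point. -/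
def MeasurableLearner {X : Type*} [MeasurableSpace X] (A : Learner X) : Prop :=
  ∀ n : ℕ, Measurable fun p : (Fin n → Example X) × X => A (List.ofFn p.1) p.2

/-- True 0-1 error of `h` under `D`. -/
noncomputable def err {X : Type*} [MeasurableSpace X] (D : Measure (Example X))
    (h : X → Bool) : ℝ :=
  D.real {z | h z.1 ≠ z.2}

/-- The best error attainable in the class `H`. -/
noncomputable def bestErr {X : Type*} [MeasurableSpace X] (D : Measure (Example X))
    (H : Set (X → Bool)) : ℝ :=
  sInf (err D '' H)

/-- The `i`-th (counting from `0`) block of `n` consecutive entries of `S`. -/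
def block {α : Type*} (S : List α) (i n : ℕ) : List α :=
  (S.drop (i * n)).take n

/-- The recursive splitting scheme, for `S` of length `3 ^ k`. If `k = k' + 6`, cut `S` into 27
blocks of length `3 ^ (k - 3) = 3 ^ (k' + 3)`; recurse on the first `3 ^ (k - 6) = 3 ^ k'` entries
of each block, putting the rest of that block in front of `T`. If `k < 6`, return `S ++ T`. -/
def splitting {α : Type*} : ℕ → List α → List α → List (List α)
  | k + 6, S, T => (List.range 27).flatMap fun i =>
      splitting k ((block S i (3 ^ (k + 3))).take (3 ^ k))
        ((block S i (3 ^ (k + 3))).drop (3 ^ k) ++ T)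
  | 0, S, T => [S ++ T]
  | 1, S, T => [S ++ T]
  | 2, S, T => [S ++ T]
  | 3, S, T => [S ++ T]
  | 4, S, T => [S ++ T]
  | 5, S, T => [S ++ T]

/-- The splitting scheme produces `27 ^ ⌊k / 6⌋` training sequences. -/
theorem length_splitting {α : Type*} (k : ℕ) (S T : List α) :
    (splitting k S T).length = 27 ^ (k / 6) := by
  induction k, S, T using splitting.induct with
  | case1 k S T ih =>
    rw [splitting, List.length_flatMap]
    have h : (k + 6) / 6 = k / 6 + 1 := by omega
    rw [List.map_congr_left (fun i _ => ih i), List.map_const', List.sum_replicate,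
      List.length_range, smul_eq_mul, h, pow_succ, mul_comm]
  | _ => simp [splitting]

/-- The `t` voters selected by the draws `i : Fin t → Fin (27 ^ (k / 6))`: the learner run on the
drawn members of the family `splitting k S []`, where `S` has length `3 ^ k`. -/
def voters {X : Type*} (A : Learner X) (k : ℕ) (S : List (Example X)) {t : ℕ}
    (i : Fin t → Fin (27 ^ (k / 6))) : Fin t → X → Bool :=
  fun j => A ((splitting k S []).get (Fin.cast (length_splitting k S []).symm (i j)))

/-- The law of the draws: `t` independent uniform draws, with replacement, from the
`27 ^ (k / 6)` members of the family. -/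
noncomputable def draws (k t : ℕ) : Measure (Fin t → Fin (27 ^ (k / 6))) :=
  Measure.pi fun _ => (PMF.uniformOfFintype (Fin (27 ^ (k / 6)))).toMeasure

/-- The fraction of the voters that predict `y` at `x`. -/
noncomputable def avgEq {X : Type*} {t : ℕ} (v : Fin t → X → Bool) (x : X) (y : Bool) : ℝ :=
  ((Finset.univ.filter fun j => v j x = y).card : ℝ) / (t : ℝ)

/-- The fraction of the voters that err on the example `(x, y)`. -/
noncomputable def avgNe {X : Type*} {t : ℕ} (v : Fin t → X → Bool) (x : X) (y : Bool) : ℝ :=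
  ((Finset.univ.filter fun j => v j x ≠ y).card : ℝ) / (t : ℝ)

open Classical in
/-- The examples of `S₃` on which at least one of the two families of voters has an error
fraction of at least `11 / 243`. -/
noncomputable def tieSample {X : Type*} {t₁ t₂ : ℕ} (v₁ : Fin t₁ → X → Bool)
    (v₂ : Fin t₂ → X → Bool) (S₃ : List (Example X)) : List (Example X) :=
  S₃.filter fun z => decide (11 / 243 ≤ avgNe v₁ z.1 z.2 ∨ 11 / 243 ≤ avgNe v₂ z.1 z.2)

/-- Both families of voters predict `y` at `x` with confidence at least `232 / 243`. -/
def BothAgree {X : Type*} {t₁ t₂ : ℕ} (v₁ : Fin t₁ → X → Bool) (v₂ : Fin t₂ → X → Bool)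
    (x : X) (y : Bool) : Prop :=
  232 / 243 ≤ avgEq v₁ x y ∧ 232 / 243 ≤ avgEq v₂ x y

open Classical in
/-- The label on which both families agree with confidence at least `232 / 243` (at most one label
qualifies), and the label given by `h` if there is none. -/
noncomputable def tie {X : Type*} {t₁ t₂ : ℕ} (v₁ : Fin t₁ → X → Bool)
    (v₂ : Fin t₂ → X → Bool) (h : X → Bool) : X → Bool := fun x =>
  if BothAgree v₁ v₂ x true then true
  else if BothAgree v₁ v₂ x false then false
  else h x

/-- The classifier produced from a training sequence `S` of length `3 ^ k` and draws `i₁`, `i₂`: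
`S` is cut into consecutive thirds, the first two of which are used for the two families of voters
and the last one for the tie-breaker. -/
noncomputable def tieMajority {X : Type*} (A : Learner X) (k : ℕ) (S : List (Example X))
    {t₁ t₂ : ℕ} (i₁ : Fin t₁ → Fin (27 ^ ((k - 1) / 6)))
    (i₂ : Fin t₂ → Fin (27 ^ ((k - 1) / 6))) : X → Bool :=
  let v₁ := voters A (k - 1) (block S 0 (3 ^ (k - 1))) i₁
  let v₂ := voters A (k - 1) (block S 1 (3 ^ (k - 1))) i₂
  tie v₁ v₂ (A (tieSample v₁ v₂ (block S 2 (3 ^ (k - 1)))))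

end TieLearn

/-! The engine is one exponential-moment inequality, `lintegral_exp_deviation_le`, for the errors of
a data-dependent hypothesis inside a region R that is independent of the sample. A ghost sample
replaces the true error by a count. Swapping the two halves at random costs nothing for a fixed
error pattern when exp(l) + exp(-κl) ≤ 2. Pajor's lemma (`card_errorPatterns_le`) bounds the number
of patterns by η^(-d) (1+η)^w, where w counts the sample points in R. After integration the price of
uniformity is d log(1/η) + 2ηn D(R). With η an absolute constant there is no log(n/d) factor as soon
as n D(R) is of order nτ + d + log(1/δ). Averages over many hypotheses cost nothing extra, by Jensen
(`measure_avg_ge_le`), so no union bound over the exponentially many training sets is needed.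

That the relevant region is so small comes from the recursion (`measure_hardRegion_gt_le`). If a
10/243 fraction of a family errs at a point, then some child i has a 10/243 fraction of erring
members, and the other children together still have many. The hard region of child i does not depend
on the part of block j that child j receives as extra data, and every member of child j is trained
on that part. The inequality therefore applies to those members inside the hard region of child i.
Its mass enters the new bound only with a tiny factor 2η, so the constant 10^8 reproduces itself at
every level.

Sampling raises the threshold from 10/243 to 11/243 (`draws_avgNe_ge_le`). An error of the final
classifier is either an error of the tie-breaker inside the region of disagreement, or an error
shared by a 232/243 fraction of both families (`tie_error_subset`). The first kind has mass about τ,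
since the tie-breaker is an ERM on the third part restricted to that region
(`measure_tieBreaker_ge_le`). The second has mass about (243/232)(27/26)τ (`measure_voters_ge_le`):
a Markov factor, times the ratio between the length of a block and the length of its fresh part. The
sum is 2.0877τ. The gap to 2.0888 absorbs the relative errors of all the deviation bounds, so the
square-root term is not even needed. -/

namespace TieLearn

open scoped ENNReal

/-! ### Error patterns and symmetrization on a finite double sample. -/

section Patterns

variable {X : Type*}

open Classical in
/-- Pajor's form of the Sauer-Shelah bound for the error patterns of a class on a finite
family of labelled points. -/
theorem card_errorPatterns_le {H : Set (X → Bool)} {d : ℕ}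
    (hd : ∀ C : Finset X, Shatters H C → C.card ≤ d) {α : Type*} [Fintype α]
    (p : α → Example X) (W : Finset α) {η : ℝ} (hη : 0 ≤ η) (hη1 : η ≤ 1) :
    ((Finset.univ.filter fun P : Finset α =>
        ∃ h ∈ H, (W.filter fun a => h (p a).1 ≠ (p a).2) = P).card : ℝ) * η ^ d
      ≤ (1 + η) ^ W.card := by
  set 𝒜 : Finset (Finset α) := Finset.univ.filter fun P : Finset α =>
        ∃ h ∈ H, (W.filter fun a => h (p a).1 ≠ (p a).2) = P with h𝒜
  have key : ∀ B ∈ 𝒜.shatterer, B ∈ W.powerset ∧ B.card ≤ d := by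
    intro B hB
    rw [Finset.mem_shatterer] at hB
    have hBW : B ⊆ W := by
      obtain ⟨t, ht, hBt⟩ := hB.exists_superset
      simp only [h𝒜, Finset.mem_filter, Finset.mem_univ, true_and] at ht
      obtain ⟨h, -, rfl⟩ := ht
      exact hBt.trans (Finset.filter_subset _ _)
    have lab : ∀ f : α → Bool, ∃ h ∈ H, ∀ a ∈ B, h (p a).1 = f a := by
      intro f
      -- With binary labels, an error pattern on B determines the labelling. To realise f, ask for
      -- the pattern of its disagreements with the given labels.
      obtain ⟨u, hu, hBu⟩ := hB (t := B.filter fun a => f a ≠ (p a).2) (Finset.filter_subset _ _)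
      simp only [h𝒜, Finset.mem_filter, Finset.mem_univ, true_and] at hu
      obtain ⟨h, hh, rfl⟩ := hu
      refine ⟨h, hh, fun a ha => ?_⟩
      have := Finset.ext_iff.1 hBu a
      simp only [Finset.mem_inter, Finset.mem_filter, ha, hBW ha, true_and] at this
      revert this
      cases h (p a).1 <;> cases f a <;> cases (p a).2 <;> simp
    -- Two indices carrying the same point cannot receive different predictions, so a shattered
    -- index set meets each point at most once and its image is a shattered set of the same size.
    have inj : Set.InjOn (fun a => (p a).1) B := by
      intro a ha b hb hab
      by_contra hne
      obtain ⟨h, -, hh⟩ := lab fun c => decide (c = a)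
      have h1 := hh a ha
      have h2 := hh b hb
      simp only at hab
      rw [hab] at h1
      rw [h1] at h2
      simp [Ne.symm hne] at h2
    refine ⟨Finset.mem_powerset.2 hBW, ?_⟩
    rw [← Finset.card_image_of_injOn inj]
    apply hd
    intro f
    obtain ⟨h, hh, hf⟩ := lab fun a => f (p a).1
    refine ⟨h, hh, fun x hx => ?_⟩
    obtain ⟨a, ha, rfl⟩ := Finset.mem_image.1 hx
    exact hf a ha
  calc (𝒜.card : ℝ) * η ^ d ≤ (𝒜.shatterer.card : ℝ) * η ^ d := by
        refine mul_le_mul_of_nonneg_right ?_ (by positivity)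
        exact_mod_cast Finset.card_le_card_shatterer 𝒜
    _ = ∑ B ∈ 𝒜.shatterer, η ^ d := by simp
    _ ≤ ∑ B ∈ 𝒜.shatterer, η ^ B.card :=
        Finset.sum_le_sum fun B hB => pow_le_pow_of_le_one hη hη1 (key B hB).2
    _ ≤ ∑ B ∈ W.powerset, η ^ B.card :=
        Finset.sum_le_sum_of_subset_of_nonneg (fun B hB => (key B hB).1) (fun _ _ _ => by positivity)
    _ = (1 + η) ^ W.card := by
        rw [← Finset.prod_const, Finset.prod_one_add]
        simp

open Classical in
/-- Averaging over the swaps of the two halves of a double sample, for a fixed pattern. -/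
theorem sum_swaps_le {J : Type*} [Fintype J] {α β : ℝ≥0∞} (hαβ : α + β ≤ 2) (hαβ1 : α * β ≤ 1)
    (P : Finset (J × Bool)) :
    ∑ σ : J → Bool, ∏ j, ((if (j, !σ j) ∈ P then α else 1) * (if (j, σ j) ∈ P then β else 1))
      ≤ 2 ^ Fintype.card J := by
  have h := Finset.prod_univ_sum (fun _ : J => (Finset.univ : Finset Bool))
    (fun j b => (if (j, !b) ∈ P then α else 1) * (if (j, b) ∈ P then β else 1))
  rw [Fintype.piFinset_univ] at h
  rw [← h]
  calc _ ≤ ∏ _j : J, (2 : ℝ≥0∞) := by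
        refine Finset.prod_le_prod' fun j _ => ?_
        rw [Fintype.sum_bool]
        -- A pair contributes 2αβ, α + β or 2 according to whether both, one or none of its points
        -- belong to the pattern.
        by_cases h1 : (j, true) ∈ P <;> by_cases h2 : (j, false) ∈ P <;> simp [h1, h2]
        · calc α * β + α * β ≤ 1 + 1 := add_le_add hαβ1 hαβ1
            _ = 2 := one_add_one_eq_two
        · rwa [add_comm]
        · exact hαβ
        · rw [one_add_one_eq_two]
    _ = _ := by simp

open Classical in
-- The pattern may depend on σ, but it ranges over a family that does not. Bounding each term by the
-- sum over the whole family reduces to fixed patterns.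
theorem sum_le_of_patterns {J : Type*} [Fintype J] {α β : ℝ≥0∞} (hαβ : α + β ≤ 2)
    (hαβ1 : α * β ≤ 1) (𝓟 : Finset (Finset (J × Bool))) (F : (J → Bool) → ℝ≥0∞)
    (hF : ∀ σ, ∃ P ∈ 𝓟, F σ =
      ∏ j, ((if (j, !σ j) ∈ P then α else 1) * (if (j, σ j) ∈ P then β else 1))) :
    ∑ σ, F σ ≤ 2 ^ Fintype.card J * (𝓟.card : ℝ≥0∞) := by
  calc ∑ σ, F σ ≤ ∑ σ : J → Bool, ∑ P ∈ 𝓟, ∏ j,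
        ((if (j, !σ j) ∈ P then α else 1) * (if (j, σ j) ∈ P then β else 1)) := by
        refine Finset.sum_le_sum fun σ _ => ?_
        obtain ⟨P, hP, h⟩ := hF σ
        rw [h]
        exact Finset.single_le_sum (f := fun P => ∏ j,
          ((if (j, !σ j) ∈ P then α else 1) * (if (j, σ j) ∈ P then β else 1)))
          (fun _ _ => zero_le) hP
    _ = ∑ P ∈ 𝓟, ∑ σ : J → Bool, ∏ j,
        ((if (j, !σ j) ∈ P then α else 1) * (if (j, σ j) ∈ P then β else 1)) :=
        Finset.sum_comm
    _ ≤ ∑ P ∈ 𝓟, 2 ^ Fintype.card J :=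
        Finset.sum_le_sum fun P _ => sum_swaps_le hαβ hαβ1 P
    _ = _ := by rw [Finset.sum_const, nsmul_eq_mul, mul_comm]

end Patterns

/-! ### Integrals of products over independent coordinates. -/

section Product

theorem lintegral_pi_prod_apply {J Z : Type*} [Fintype J] [MeasurableSpace Z] (D : Measure Z)
    [IsProbabilityMeasure D] {f : J → Z → ℝ≥0∞} (hf : ∀ j, Measurable (f j)) :
    ∫⁻ u, ∏ j, f j (u j) ∂(Measure.pi fun _ : J => D) = ∏ j, ∫⁻ z, f j z ∂D := by
  have hi := ProbabilityTheory.iIndepFun_pi (μ := fun _ : J => D) (X := f)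
    (fun j => (hf j).aemeasurable)
  rw [ProbabilityTheory.lintegral_prod_eq_prod_lintegral_of_indepFun Finset.univ _ hi
    (fun j => (hf j).comp (measurable_pi_apply j))]
  refine Finset.prod_congr rfl fun j _ => ?_
  exact (measurePreserving_eval (fun _ : J => D) j).lintegral_comp (hf j)

theorem lintegral_pi_prod {J Z : Type*} [Fintype J] [MeasurableSpace Z] (D : Measure Z)
    [IsProbabilityMeasure D] {f : Z → ℝ≥0∞} (hf : Measurable f) :
    ∫⁻ u, ∏ j, f (u j) ∂(Measure.pi fun _ : J => D) = (∫⁻ z, f z ∂D) ^ Fintype.card J := by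
  rw [lintegral_pi_prod_apply D fun _ => hf, Finset.prod_const, Finset.card_univ]

open Classical in
theorem lintegral_ite_mem {Z : Type*} [MeasurableSpace Z] (D : Measure Z)
    [IsProbabilityMeasure D] {E : Set Z} (hE : MeasurableSet E) {a : ℝ} (ha : 0 ≤ a) :
    ∫⁻ z, (if z ∈ E then ENNReal.ofReal a else 1) ∂D = ENNReal.ofReal (1 + D.real E * (a - 1)) := by
  have h1 : (fun z => if z ∈ E then ENNReal.ofReal a else 1)
      = fun z => E.indicator (fun _ => ENNReal.ofReal a) z + Eᶜ.indicator (fun _ => 1) z := by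
    ext z
    by_cases hz : z ∈ E <;> simp [hz]
  rw [h1, lintegral_add_left (measurable_const.indicator hE), lintegral_indicator_const hE,
    lintegral_indicator_const hE.compl, ← ofReal_measureReal, ← ofReal_measureReal,
    probReal_compl_eq_one_sub hE, ← ENNReal.ofReal_mul ha, one_mul,
    ← ENNReal.ofReal_add (mul_nonneg ha measureReal_nonneg) (by linarith [measureReal_le_one (μ := D) (s := E)])]
  congr 1
  ring

open Classical in
theorem lintegral_pi_prod_ite_mem {J Z : Type*} [Fintype J] [MeasurableSpace Z] (D : Measure Z)
    [IsProbabilityMeasure D] {E : Set Z} (hE : MeasurableSet E) {a : ℝ} (ha : 0 ≤ a) :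
    ∫⁻ u, ∏ j, (if u j ∈ E then ENNReal.ofReal a else 1) ∂(Measure.pi fun _ : J => D)
      = ENNReal.ofReal (1 + D.real E * (a - 1)) ^ Fintype.card J := by
  rw [lintegral_pi_prod D (f := fun z => if z ∈ E then ENNReal.ofReal a else 1)
    (Measurable.ite hE measurable_const measurable_const), lintegral_ite_mem D hE ha]

/-- Convexity of the exponential on the segment from 0 to l. The right side is the moment generating
function of a Bernoulli(p) variable, which is how a ghost point enters. -/
theorem exp_mul_le_one_add {p : ℝ} (hp : 0 ≤ p) (hp1 : p ≤ 1) (l : ℝ) :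
    Real.exp (p * l) ≤ 1 + p * (Real.exp l - 1) := by
  have := convexOn_exp.2 (Set.mem_univ 0) (Set.mem_univ l) (sub_nonneg.2 hp1) hp (by ring)
  simp only [smul_eq_mul, mul_zero, zero_add, Real.exp_zero, mul_one] at this
  linarith

end Product

/-! ### Relative deviation bound inside a fixed region. -/

section Deviation

variable {X : Type*} [MeasurableSpace X]

open Classical in
-- Given the first half of the double sample, the hypothesis is fixed and each ghost point is an
-- independent Bernoulli trial, so exp(lnp) is at most the expected product over the ghost points.
-- No second-half deviation estimate is required.
theorem lintegral_exp_deviation_le_ghost {J : Type*} [Fintype J] (D : Measure (Example X))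
    [IsProbabilityMeasure D] {R : Set (Example X)} (hR : MeasurableSet R)
    {g : (J → Example X) → X → Bool} (hg : Measurable fun p : (J → Example X) × X => g p.1 p.2)
    {l κ : ℝ} :
    ∫⁻ u, ENNReal.ofReal (Real.exp (l * (Fintype.card J * D.real {z | z ∈ R ∧ g u z.1 ≠ z.2}
        - κ * (Finset.univ.filter fun j => u j ∈ R ∧ g u (u j).1 ≠ (u j).2).card)))
        ∂(Measure.pi fun _ : J => D)
      ≤ ∫⁻ w : J → Example X × Example X,
        ∏ j, ((if (w j).2 ∈ R ∧ g (fun j => (w j).1) (w j).2.1 ≠ (w j).2.2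
            then ENNReal.ofReal (Real.exp l) else 1)
          * (if (w j).1 ∈ R ∧ g (fun j => (w j).1) (w j).1.1 ≠ (w j).1.2
            then ENNReal.ofReal (Real.exp (-(κ * l))) else 1))
        ∂(Measure.pi fun _ : J => D.prod D) := by
  have hset : MeasurableSet {q : (J → Example X) × Example X | q.2 ∈ R ∧ g q.1 q.2.1 ≠ q.2.2} := by
    apply MeasurableSet.inter (measurable_snd hR)
    have h1 : Measurable fun q : (J → Example X) × Example X => g q.1 q.2.1 :=
      hg.comp (measurable_fst.prodMk (measurable_fst.comp measurable_snd))
    exact (measurableSet_eq_fun h1 (measurable_snd.comp measurable_snd)).compl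
  set Φ : (J → Example X) × (J → Example X) → ℝ≥0∞ := fun q =>
    ∏ j, ((if q.2 j ∈ R ∧ g q.1 (q.2 j).1 ≠ (q.2 j).2 then ENNReal.ofReal (Real.exp l) else 1)
      * (if q.1 j ∈ R ∧ g q.1 (q.1 j).1 ≠ (q.1 j).2
        then ENNReal.ofReal (Real.exp (-(κ * l))) else 1)) with hΦ
  have hΦm : Measurable Φ := by
    refine Finset.measurable_prod _ fun j _ => ?_
    refine Measurable.mul ?_ ?_
    · refine Measurable.ite ?_ measurable_const measurable_const
      have : Measurable fun q : (J → Example X) × (J → Example X) => (q.1, q.2 j) := by fun_prop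
      exact this hset
    · refine Measurable.ite ?_ measurable_const measurable_const
      have : Measurable fun q : (J → Example X) × (J → Example X) => (q.1, q.1 j) := by fun_prop
      exact this hset
  have hmp := measurePreserving_arrowProdEquivProdArrow (Example X) (Example X) J
    (fun _ => D) (fun _ => D)
  have e1 := hmp.lintegral_comp hΦm
  have e2 : ∀ w, Φ ((MeasurableEquiv.arrowProdEquivProdArrow (Example X) (Example X) J) w) =
    ∏ j, ((if (w j).2 ∈ R ∧ g (fun j => (w j).1) (w j).2.1 ≠ (w j).2.2
            then ENNReal.ofReal (Real.exp l) else 1)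
          * (if (w j).1 ∈ R ∧ g (fun j => (w j).1) (w j).1.1 ≠ (w j).1.2
            then ENNReal.ofReal (Real.exp (-(κ * l))) else 1)) := fun w => rfl
  simp_rw [← e2]
  rw [e1, lintegral_prod _ hΦm.aemeasurable]
  refine lintegral_mono fun u => ?_
  have hEu : MeasurableSet {z : Example X | z ∈ R ∧ g u z.1 ≠ z.2} :=
    (measurable_const.prodMk measurable_id) hset
  have hsplit : ∀ y, Φ (u, y) =
      (∏ j, if y j ∈ R ∧ g u (y j).1 ≠ (y j).2 then ENNReal.ofReal (Real.exp l) else 1)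
      * ∏ j, if u j ∈ R ∧ g u (u j).1 ≠ (u j).2
        then ENNReal.ofReal (Real.exp (-(κ * l))) else 1 := fun y => Finset.prod_mul_distrib
  rw [lintegral_congr hsplit, lintegral_mul_const' _ _ (by
    refine ENNReal.prod_ne_top fun j _ => ?_
    split_ifs <;> simp)]
  have hghost : ∫⁻ y, (∏ j, if y j ∈ R ∧ g u (y j).1 ≠ (y j).2
        then ENNReal.ofReal (Real.exp l) else 1) ∂(Measure.pi fun _ : J => D)
      = ENNReal.ofReal (1 + D.real {z : Example X | z ∈ R ∧ g u z.1 ≠ z.2} * (Real.exp l - 1))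
        ^ Fintype.card J := by
    rw [← lintegral_pi_prod_ite_mem (J := J) D hEu (Real.exp_pos l).le]
    simp only [Set.mem_ofPred_eq]
    congr!
  rw [hghost, Finset.prod_ite, Finset.prod_const, Finset.prod_const_one, mul_one,
    ← ENNReal.ofReal_pow (Real.exp_pos _).le]
  have hp0 : 0 ≤ D.real {z : Example X | z ∈ R ∧ g u z.1 ≠ z.2} := measureReal_nonneg
  have hp1 : D.real {z : Example X | z ∈ R ∧ g u z.1 ≠ z.2} ≤ 1 := measureReal_le_one
  have hle := exp_mul_le_one_add hp0 hp1 l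
  rw [← ENNReal.ofReal_pow ((Real.exp_pos _).le.trans hle), ← ENNReal.ofReal_mul
    (pow_nonneg ((Real.exp_pos _).le.trans hle) _)]
  apply ENNReal.ofReal_le_ofReal
  calc _ = Real.exp (D.real {z : Example X | z ∈ R ∧ g u z.1 ≠ z.2} * l) ^ Fintype.card J
      * Real.exp (-(κ * l)) ^
        (Finset.univ.filter fun j => u j ∈ R ∧ g u (u j).1 ≠ (u j).2).card := by
        rw [← Real.exp_nat_mul, ← Real.exp_nat_mul, ← Real.exp_add]
        congr 1
        ring
    _ ≤ _ := by gcongr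

open Classical in
/-- Exponential moment bound for the one-sided relative deviation, inside a region `R`, of the
empirical errors of a data-dependent hypothesis from a class of VC dimension at most `d`. -/
theorem lintegral_exp_deviation_le {J : Type*} [Fintype J] {H : Set (X → Bool)} {d : ℕ}
    (hd : ∀ C : Finset X, Shatters H C → C.card ≤ d) (D : Measure (Example X))
    [IsProbabilityMeasure D] {R : Set (Example X)} (hR : MeasurableSet R)
    {g : (J → Example X) → X → Bool} (hg : Measurable fun p : (J → Example X) × X => g p.1 p.2)
    (hgH : ∀ u, g u ∈ H) {l κ η : ℝ} (hl : 0 ≤ l) (hκ : 1 ≤ κ)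
    (hlκ : Real.exp l + Real.exp (-(κ * l)) ≤ 2) (hη : 0 < η) (hη1 : η ≤ 1) :
    ∫⁻ u, ENNReal.ofReal (Real.exp (l * (Fintype.card J * D.real {z | z ∈ R ∧ g u z.1 ≠ z.2}
        - κ * (Finset.univ.filter fun j => u j ∈ R ∧ g u (u j).1 ≠ (u j).2).card)))
        ∂(Measure.pi fun _ : J => D)
      ≤ ENNReal.ofReal ((η ^ d)⁻¹ * Real.exp (2 * η * Fintype.card J * D.real R)) := by
  refine (lintegral_exp_deviation_le_ghost D hR hg).trans ?_
  set α := ENNReal.ofReal (Real.exp l) with hα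
  set β := ENNReal.ofReal (Real.exp (-(κ * l))) with hβ
  have hαβ : α + β ≤ 2 := by
    rw [hα, hβ, ← ENNReal.ofReal_add (Real.exp_pos _).le (Real.exp_pos _).le]
    calc _ ≤ ENNReal.ofReal 2 := ENNReal.ofReal_le_ofReal hlκ
      _ = 2 := by simp
  have hαβ1 : α * β ≤ 1 := by
    rw [hα, hβ, ← ENNReal.ofReal_mul (Real.exp_pos _).le, ← Real.exp_add]
    calc _ ≤ ENNReal.ofReal 1 := ENNReal.ofReal_le_ofReal (by
            rw [Real.exp_le_one_iff]; nlinarith)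
      _ = 1 := by simp
  set Φ : (J → Example X × Example X) → ℝ≥0∞ := fun w =>
        ∏ j, ((if (w j).2 ∈ R ∧ g (fun j => (w j).1) (w j).2.1 ≠ (w j).2.2 then α else 1)
          * (if (w j).1 ∈ R ∧ g (fun j => (w j).1) (w j).1.1 ≠ (w j).1.2 then β else 1)) with hΦ
  have hset : MeasurableSet {q : (J → Example X) × Example X | q.2 ∈ R ∧ g q.1 q.2.1 ≠ q.2.2} := by
    apply MeasurableSet.inter (measurable_snd hR)
    have h1 : Measurable fun q : (J → Example X) × Example X => g q.1 q.2.1 :=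
      hg.comp (measurable_fst.prodMk (measurable_fst.comp measurable_snd))
    exact (measurableSet_eq_fun h1 (measurable_snd.comp measurable_snd)).compl
  have hfst : Measurable fun (w : J → Example X × Example X) (j : J) => (w j).1 :=
    measurable_pi_lambda _ fun j => measurable_fst.comp (measurable_pi_apply j)
  have hΦm : Measurable Φ := by
    refine Finset.measurable_prod _ fun j _ => ?_
    refine Measurable.mul ?_ ?_
    · refine Measurable.ite ?_ measurable_const measurable_const
      exact (hfst.prodMk (measurable_snd.comp (measurable_pi_apply j))) hset
    · refine Measurable.ite ?_ measurable_const measurable_const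
      exact (hfst.prodMk (measurable_fst.comp (measurable_pi_apply j))) hset
  set sw : (J → Bool) → (J → Example X × Example X) → J → Example X × Example X :=
    fun σ w j => (if σ j then Prod.swap else id) (w j) with hsw
  have hswm : ∀ σ, MeasurePreserving (sw σ) (Measure.pi fun _ : J => D.prod D)
      (Measure.pi fun _ : J => D.prod D) := by
    intro σ
    refine measurePreserving_pi _ _ fun j => ?_
    cases σ j
    · exact MeasurePreserving.id _
    · exact Measure.measurePreserving_swap
  -- The double sample is indexed without reference to σ. Swapping changes which half is used for
  -- training, but not the family of patterns available on these points.
  set pt : (J → Example X × Example X) → J × Bool → Example X :=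
    fun w a => if a.2 then (w a.1).2 else (w a.1).1 with hpt
  set W : (J → Example X × Example X) → Finset (J × Bool) :=
    fun w => Finset.univ.filter fun a => pt w a ∈ R with hW
  set 𝓟 : (J → Example X × Example X) → Finset (Finset (J × Bool)) := fun w =>
    Finset.univ.filter fun P => ∃ h ∈ H, ((W w).filter fun a => h (pt w a).1 ≠ (pt w a).2) = P
    with h𝓟
  have hpoint : ∀ w, ∑ σ, Φ (sw σ w) ≤ 2 ^ Fintype.card J * ((𝓟 w).card : ℝ≥0∞) := by
    intro w
    refine sum_le_of_patterns hαβ hαβ1 (𝓟 w) (fun σ => Φ (sw σ w)) fun σ => ?_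
    refine ⟨(W w).filter fun a => g (fun j => (sw σ w j).1) (pt w a).1 ≠ (pt w a).2,
      Finset.mem_filter.2 ⟨Finset.mem_univ _, _, hgH _, rfl⟩, ?_⟩
    refine Finset.prod_congr rfl fun j _ => ?_
    have e1 : (sw σ w j).1 = pt w (j, σ j) := by
      cases hσ : σ j <;> simp [hsw, hpt, hσ]
    have e2 : (sw σ w j).2 = pt w (j, !σ j) := by
      cases hσ : σ j <;> simp [hsw, hpt, hσ]
    simp only [hW, Finset.mem_filter, Finset.mem_univ, true_and, ← e1, ← e2]
  set b : Example X → ℝ≥0∞ := fun z => if z ∈ R then ENNReal.ofReal (1 + η) else 1 with hb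
  have hbm : Measurable b := Measurable.ite hR measurable_const measurable_const
  have hcard : ∀ w, ((𝓟 w).card : ℝ≥0∞) ≤ ENNReal.ofReal ((η ^ d)⁻¹) * ∏ j, b (w j).1 * b (w j).2 := by
    intro w
    have h1 := card_errorPatterns_le hd (pt w) (W w) hη.le hη1
    have h2 : ∏ j, b (w j).1 * b (w j).2 = ENNReal.ofReal ((1 + η) ^ (W w).card) := by
      rw [ENNReal.ofReal_pow (by positivity), ← Finset.prod_const, hW, Finset.prod_filter,
        Fintype.prod_prod_type]
      refine Finset.prod_congr rfl fun j _ => ?_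
      simp [hpt, hb, mul_comm]
    rw [h2, ← ENNReal.ofReal_mul (by positivity), ← ENNReal.ofReal_natCast]
    apply ENNReal.ofReal_le_ofReal
    rw [inv_mul_eq_div, le_div_iff₀ (by positivity)]
    exact h1
  -- Only points in R contribute to the pattern count, so its expectation involves (1 + η D(R))^(2n)
  -- ≤ exp(2ηn D(R)) instead of (1 + η)^(2n).
  have hInt : ∫⁻ w, ∏ j, b (w j).1 * b (w j).2 ∂(Measure.pi fun _ : J => D.prod D)
      ≤ ENNReal.ofReal (Real.exp (2 * η * Fintype.card J * D.real R)) := by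
    rw [lintegral_pi_prod (D.prod D) (f := fun z => b z.1 * b z.2)
      ((hbm.comp measurable_fst).mul (hbm.comp measurable_snd)),
      lintegral_prod_mul hbm.aemeasurable hbm.aemeasurable, hb,
      lintegral_ite_mem D hR (by positivity)]
    have hp : 0 ≤ D.real R := measureReal_nonneg
    have h0 : (0 : ℝ) ≤ 1 + D.real R * (1 + η - 1) := by
      have : 0 ≤ D.real R * η := by positivity
      linarith
    rw [← ENNReal.ofReal_mul h0, ← ENNReal.ofReal_pow (mul_nonneg h0 h0)]
    apply ENNReal.ofReal_le_ofReal
    calc _ ≤ (Real.exp (η * D.real R) * Real.exp (η * D.real R)) ^ Fintype.card J := by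
          have : 1 + D.real R * (1 + η - 1) ≤ Real.exp (η * D.real R) := by
            have := Real.add_one_le_exp (η * D.real R)
            linarith
          gcongr
      _ = _ := by
          rw [← Real.exp_add, ← Real.exp_nat_mul]
          congr 1
          ring
  -- Every swap preserves the law of the double sample, so the integral equals its average over all
  -- swaps.
  have hsum : (2 : ℝ≥0∞) ^ Fintype.card J * ∫⁻ w, Φ w ∂(Measure.pi fun _ : J => D.prod D)
      = ∫⁻ w, ∑ σ, Φ (sw σ w) ∂(Measure.pi fun _ : J => D.prod D) := by
    rw [lintegral_finsetSum (f := fun σ w => Φ (sw σ w)) _ fun σ _ => hΦm.comp (hswm σ).measurable]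
    rw [Finset.sum_congr rfl fun σ _ => (hswm σ).lintegral_comp hΦm]
    simp
  have h2 : (2 : ℝ≥0∞) ^ Fintype.card J ≠ 0 := by simp
  have h2' : (2 : ℝ≥0∞) ^ Fintype.card J ≠ ∞ := by simp
  rw [← ENNReal.mul_le_mul_iff_right h2 h2', hsum]
  calc _ ≤ ∫⁻ w, 2 ^ Fintype.card J * (ENNReal.ofReal ((η ^ d)⁻¹) * ∏ j, b (w j).1 * b (w j).2)
        ∂(Measure.pi fun _ : J => D.prod D) := by
        refine lintegral_mono fun w => (hpoint w).trans ?_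
        gcongr
        exact hcard w
    _ ≤ _ := by
        rw [lintegral_const_mul' _ _ h2', lintegral_const_mul' _ _ ENNReal.ofReal_ne_top,
          ENNReal.ofReal_mul (by positivity)]
        gcongr

end Deviation

/-! ### Averaging, fractional covers and Chernoff moments. -/

section Tools

theorem measurable_measureReal_fiber {Ω Z : Type*} [MeasurableSpace Ω] [MeasurableSpace Z]
    (D : Measure Z) [IsProbabilityMeasure D] {s : Set (Ω × Z)} (hs : MeasurableSet s) :
    Measurable fun ω => D.real {z | (ω, z) ∈ s} :=
  (measurable_measure_prodMk_left hs).ennreal_toReal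

open Classical in
theorem measurable_countP {Ω ι : Type*} [MeasurableSpace Ω] {p : Ω → ι → Prop}
    (hp : ∀ i, MeasurableSet {ω | p ω i}) (I : List ι) :
    Measurable fun ω => I.countP fun i => decide (p ω i) := by
  induction I with
  | nil => simp
  | cons a I ih =>
    simp only [List.countP_cons, decide_eq_true_eq]
    exact ih.add (Measurable.ite (hp a) measurable_const measurable_const)

/-- Markov's inequality for the exponential of an average. -/
theorem measure_avg_ge_le {Ω : Type*} [MeasurableSpace Ω] {μ : Measure Ω} {ρ : Type*} [Fintype ρ]
    [Nonempty ρ] {Y : ρ → Ω → ℝ} (hY : ∀ r, Measurable (Y r)) {M : ℝ} (hM : 0 < M)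
    (hInt : ∀ r, ∫⁻ ω, ENNReal.ofReal (Real.exp (Y r ω)) ∂μ ≤ ENNReal.ofReal M)
    {δ : ℝ} (hδ : 0 < δ) :
    μ {ω | Real.log (M / δ) ≤ (∑ r, Y r ω) / Fintype.card ρ} ≤ ENNReal.ofReal δ := by
  have hn : (0 : ℝ) < Fintype.card ρ := by exact_mod_cast Fintype.card_pos
  set w : ℝ := 1 / Fintype.card ρ with hw
  have hw0 : 0 ≤ w := by positivity
  have hw1 : ∑ _r : ρ, w = 1 := by simp [hw]
  have havg : ∀ ω, (∑ r, Y r ω) / Fintype.card ρ = ∑ r, w * Y r ω := by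
    intro ω
    rw [← Finset.mul_sum, hw]
    ring
  -- Jensen keeps the moment bound M for the average, independently of the number of terms.
  have hJ : ∀ ω, Real.exp ((∑ r, Y r ω) / Fintype.card ρ) ≤ ∑ r, w * Real.exp (Y r ω) := by
    intro ω
    rw [havg]
    simpa using convexOn_exp.map_sum_le (t := Finset.univ) (w := fun _ : ρ => w)
      (p := fun r => Y r ω) (fun _ _ => hw0) hw1 (fun _ _ => Set.mem_univ _)
  have hm : Measurable fun ω => ENNReal.ofReal (Real.exp ((∑ r, Y r ω) / Fintype.card ρ)) :=
    (Real.measurable_exp.comp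
      ((Finset.measurable_sum _ fun r _ => hY r).div_const _)).ennreal_ofReal
  have hI : ∫⁻ ω, ENNReal.ofReal (Real.exp ((∑ r, Y r ω) / Fintype.card ρ)) ∂μ
      ≤ ENNReal.ofReal M := by
    calc _ ≤ ∫⁻ ω, ∑ r, ENNReal.ofReal w * ENNReal.ofReal (Real.exp (Y r ω)) ∂μ := by
          refine lintegral_mono fun ω => (ENNReal.ofReal_le_ofReal (hJ ω)).trans (le_of_eq ?_)
          rw [ENNReal.ofReal_sum_of_nonneg fun r _ => mul_nonneg hw0 (Real.exp_pos _).le]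
          exact Finset.sum_congr rfl fun r _ => ENNReal.ofReal_mul hw0
      _ = ∑ r, ENNReal.ofReal w * ∫⁻ ω, ENNReal.ofReal (Real.exp (Y r ω)) ∂μ := by
          rw [lintegral_finsetSum
            (f := fun r ω => ENNReal.ofReal w * ENNReal.ofReal (Real.exp (Y r ω))) _ fun r _ =>
            ((Real.measurable_exp.comp (hY r)).ennreal_ofReal).const_mul _]
          exact Finset.sum_congr rfl fun r _ => lintegral_const_mul' _ _ ENNReal.ofReal_ne_top
      _ ≤ ∑ _r : ρ, ENNReal.ofReal w * ENNReal.ofReal M := by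
          gcongr with r
          exact hInt r
      _ = ENNReal.ofReal M := by
          rw [← Finset.sum_mul, ← ENNReal.ofReal_sum_of_nonneg fun _ _ => hw0, hw1]
          simp
  have hMδ : 0 < M / δ := by positivity
  calc _ ≤ μ {ω | ENNReal.ofReal (M / δ)
        ≤ ENNReal.ofReal (Real.exp ((∑ r, Y r ω) / Fintype.card ρ))} := by
        refine measure_mono fun ω hω => ?_
        apply ENNReal.ofReal_le_ofReal
        rwa [← Real.log_le_iff_le_exp hMδ]
    _ ≤ _ := meas_ge_le_lintegral_div hm.aemeasurable (by simpa using hMδ) ENNReal.ofReal_ne_top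
    _ ≤ ENNReal.ofReal M / ENNReal.ofReal (M / δ) := by gcongr
    _ = ENNReal.ofReal δ := by
        rw [← ENNReal.ofReal_div_of_pos hMδ]
        congr 1
        field_simp

/-- A fractional cover of a set bounds its measure. -/
theorem measureReal_le_sum_of_cover {Z : Type*} [MeasurableSpace Z] (D : Measure Z)
    [IsProbabilityMeasure D] {ρ : Type*} (s : Finset ρ) {B : ρ → Set Z}
    (hB : ∀ r ∈ s, MeasurableSet (B r)) {w : ρ → ℝ} (hw : ∀ r ∈ s, 0 ≤ w r) {E : Set Z}
    (hE : ∀ z ∈ E, 1 ≤ ∑ r ∈ s, w r * (B r).indicator 1 z) :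
    D.real E ≤ ∑ r ∈ s, w r * D.real (B r) := by
  have hInt : ∀ r ∈ s, Integrable (fun z => w r * (B r).indicator (1 : Z → ℝ) z) D := fun r hr =>
    (((integrable_const (1 : ℝ)).indicator (hB r hr))).const_mul _
  have h2 : ∫ z, ∑ r ∈ s, w r * (B r).indicator (1 : Z → ℝ) z ∂D = ∑ r ∈ s, w r * D.real (B r) := by
    rw [integral_finsetSum _ hInt]
    refine Finset.sum_congr rfl fun r hr => ?_
    rw [integral_const_mul, integral_indicator_one (hB r hr)]
  rw [← h2]
  have h3 := mul_meas_ge_le_integral_of_nonneg (μ := D)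
    (f := fun z => ∑ r ∈ s, w r * (B r).indicator (1 : Z → ℝ) z)
    (Filter.Eventually.of_forall fun z => Finset.sum_nonneg fun r hr =>
      mul_nonneg (hw r hr) (Set.indicator_nonneg (fun _ _ => zero_le_one) _))
    (integrable_finsetSum _ hInt) 1
  rw [one_mul] at h3
  exact (measureReal_mono hE).trans h3

theorem exp_le_one_add_add_sq {x : ℝ} (hx : |x| ≤ 1) : Real.exp x ≤ 1 + x + x ^ 2 := by
  have := Real.abs_exp_sub_one_sub_id_le hx
  linarith [(abs_le.1 this).2]

open Classical in
theorem prod_ite_mem_list {ι : Type*} [Fintype ι] {I : List ι} (hI : I.Nodup) (p : ι → Prop)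
    (a : ℝ≥0∞) :
    ∏ i, (if i ∈ I ∧ p i then a else 1) = a ^ I.countP fun i => decide (p i) := by
  rw [← List.Nodup.card_eq_countP hI, Finset.prod_ite, Finset.prod_const, Finset.prod_const_one,
    mul_one]
  congr 2
  ext i
  simp

open Classical in
/-- Chernoff bound, as an exponential moment, for the number of hits of a fixed set. -/
theorem lintegral_exp_countP_le {ι Z : Type*} [Fintype ι] [MeasurableSpace Z] (D : Measure Z)
    [IsProbabilityMeasure D] {E : Set Z} (hE : MeasurableSet E) {I : List ι} (hI : I.Nodup)
    {l κ : ℝ} (hlκ : Real.exp l ≤ 1 + κ * l) :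
    ∫⁻ ω, ENNReal.ofReal (Real.exp (l * (I.countP fun i => decide (ω i ∈ E))
        - κ * l * (I.length * D.real E))) ∂(Measure.pi fun _ : ι => D) ≤ ENNReal.ofReal 1 := by
  have h1 : ∀ ω : ι → Z, ENNReal.ofReal (Real.exp (l * (I.countP fun i => decide (ω i ∈ E))
        - κ * l * (I.length * D.real E)))
      = ENNReal.ofReal (Real.exp (-(κ * l * (I.length * D.real E))))
        * ∏ i, (if i ∈ I ∧ ω i ∈ E then ENNReal.ofReal (Real.exp l) else 1) := by
    intro ω
    rw [prod_ite_mem_list hI fun i => ω i ∈ E, ← ENNReal.ofReal_pow (Real.exp_pos _).le,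
      ← ENNReal.ofReal_mul (Real.exp_pos _).le, ← Real.exp_nat_mul, ← Real.exp_add]
    congr 2
    ring
  rw [lintegral_congr h1, lintegral_const_mul' _ _ ENNReal.ofReal_ne_top,
    lintegral_pi_prod_apply D
      (f := fun i z => if i ∈ I ∧ z ∈ E then ENNReal.ofReal (Real.exp l) else 1)
      (fun i => Measurable.ite ((MeasurableSet.const _).inter hE) measurable_const measurable_const)]
  have h2 : ∀ i, ∫⁻ z, (if i ∈ I ∧ z ∈ E then ENNReal.ofReal (Real.exp l) else 1) ∂D
      = if i ∈ I then ENNReal.ofReal (1 + D.real E * (Real.exp l - 1)) else 1 := by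
    intro i
    by_cases hi : i ∈ I
    · simp only [hi, true_and]
      rw [lintegral_ite_mem D hE (Real.exp_pos _).le, if_pos trivial]
    · simp [hi]
  have hp : 0 ≤ D.real E := measureReal_nonneg
  have hp1 : D.real E ≤ 1 := measureReal_le_one
  have h0 := (Real.exp_pos _).le.trans (exp_mul_le_one_add hp hp1 l)
  have hcard : (Finset.univ.filter fun i => i ∈ I).card = I.length := by
    rw [← List.toFinset_card_of_nodup hI]
    congr 1
    ext i
    simp
  rw [Finset.prod_congr rfl fun i _ => h2 i, Finset.prod_ite, Finset.prod_const,
    Finset.prod_const_one, mul_one, hcard,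
    ← ENNReal.ofReal_pow h0, ← ENNReal.ofReal_mul (Real.exp_pos _).le]
  apply ENNReal.ofReal_le_ofReal
  calc _ ≤ Real.exp (-(κ * l * (I.length * D.real E))) * Real.exp (D.real E * (κ * l)) ^ I.length := by
        gcongr
        calc 1 + D.real E * (Real.exp l - 1) ≤ D.real E * (κ * l) + 1 := by nlinarith
          _ ≤ _ := Real.add_one_le_exp _
    _ = 1 := by
        rw [← Real.exp_nat_mul, ← Real.exp_add]
        convert Real.exp_zero using 2
        ring

end Tools

/-! ### Conditioning on the part of the sample that determines the region. -/

section Lift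

variable {X : Type*} [MeasurableSpace X] {ι : Type*}

open Classical in
/-- The relative deviation, inside the region `R ω`, between the true error of `g ω` and its
errors on the part of the sample indexed by `I`, compensated by the mass of the region. -/
noncomputable def deviation (D : Measure (Example X)) (I : List ι)
    (R : (ι → Example X) → Set (Example X)) (g : (ι → Example X) → X → Bool) (l κ η : ℝ)
    (ω : ι → Example X) : ℝ :=
  l * (I.length * D.real {z | z ∈ R ω ∧ g ω z.1 ≠ z.2}
    - κ * (I.countP fun i => decide (ω i ∈ R ω ∧ g ω (ω i).1 ≠ (ω i).2)))
    - 2 * η * I.length * D.real (R ω)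

theorem measurableSet_errors {Ω : Type*} [MeasurableSpace Ω] {R : Ω → Set (Example X)}
    (hR : MeasurableSet {q : Ω × Example X | q.2 ∈ R q.1}) {g : Ω → X → Bool}
    (hg : Measurable fun p : Ω × X => g p.1 p.2) :
    MeasurableSet {q : Ω × Example X | q.2 ∈ R q.1 ∧ g q.1 q.2.1 ≠ q.2.2} := by
  refine MeasurableSet.inter hR ?_
  have h1 : Measurable fun q : Ω × Example X => g q.1 q.2.1 :=
    hg.comp (measurable_fst.prodMk (measurable_fst.comp measurable_snd))
  exact (measurableSet_eq_fun h1 (measurable_snd.comp measurable_snd)).compl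

open Classical in
theorem measurable_deviation (D : Measure (Example X)) [IsProbabilityMeasure D] (I : List ι)
    {R : (ι → Example X) → Set (Example X)}
    (hR : MeasurableSet {q : (ι → Example X) × Example X | q.2 ∈ R q.1})
    {g : (ι → Example X) → X → Bool} (hg : Measurable fun p : (ι → Example X) × X => g p.1 p.2)
    (l κ η : ℝ) : Measurable (deviation D I R g l κ η) := by
  have hs := measurableSet_errors hR hg
  have h1 : Measurable fun ω => D.real {z | z ∈ R ω ∧ g ω z.1 ≠ z.2} :=
    measurable_measureReal_fiber D hs
  have h2 : Measurable fun ω => D.real (R ω) := measurable_measureReal_fiber D hR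
  have h3 := measurable_countP (p := fun ω i => ω i ∈ R ω ∧ g ω (ω i).1 ≠ (ω i).2)
    (fun i => by
      have : Measurable fun ω : ι → Example X => (ω, ω i) := by fun_prop
      exact this hs) I
  have h4 : Measurable fun ω => ((I.countP fun i =>
      decide (ω i ∈ R ω ∧ g ω (ω i).1 ≠ (ω i).2) : ℕ) : ℝ) := by
    refine (Measurable.of_discrete (f := fun n : ℕ => (n : ℝ))).comp ?_
    convert h3
  unfold deviation
  fun_prop

/-- The exponential moment bound when the region depends on the rest of the sample. -/
theorem lintegral_exp_deviation_le_one [Fintype ι] {H : Set (X → Bool)} {d : ℕ}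
    (hd : ∀ C : Finset X, Shatters H C → C.card ≤ d) (D : Measure (Example X))
    [IsProbabilityMeasure D] {I : List ι} (hI : I.Nodup)
    {R : (ι → Example X) → Set (Example X)}
    (hR : MeasurableSet {q : (ι → Example X) × Example X | q.2 ∈ R q.1})
    (hRI : ∀ ω ω' : ι → Example X, (∀ i, i ∉ I → ω i = ω' i) → R ω = R ω')
    {g : (ι → Example X) → X → Bool} (hg : Measurable fun p : (ι → Example X) × X => g p.1 p.2)
    (hgH : ∀ u, g u ∈ H) {l κ η : ℝ} (hl : 0 ≤ l) (hκ : 1 ≤ κ)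
    (hlκ : Real.exp l + Real.exp (-(κ * l)) ≤ 2) (hη : 0 < η) (hη1 : η ≤ 1) :
    ∫⁻ ω, ENNReal.ofReal (Real.exp (deviation D I R g l κ η ω)) ∂(Measure.pi fun _ : ι => D)
      ≤ ENNReal.ofReal ((η ^ d)⁻¹) := by
  classical
  obtain ⟨P, hP⟩ : ∃ P : ι → Prop, ∀ i, P i ↔ i ∈ I := ⟨fun i => i ∈ I, fun _ => Iff.rfl⟩
  set e := MeasurableEquiv.piEquivPiSubtypeProd (fun _ : ι => Example X) P with he
  have hmp : MeasurePreserving e.symm _ _ :=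
    (measurePreserving_piEquivPiSubtypeProd (fun _ : ι => D) P).symm
  have hFm : Measurable fun ω => ENNReal.ofReal (Real.exp (deviation D I R g l κ η ω)) :=
    (Real.measurable_exp.comp (measurable_deviation D I hR hg l κ η)).ennreal_ofReal
  rw [← hmp.lintegral_comp hFm,
    lintegral_prod_symm' (fun p => ENNReal.ofReal (Real.exp (deviation D I R g l κ η (e.symm p))))
      (hFm.comp e.symm.measurable)]
  have hcard : Fintype.card {i // P i} = I.length := by
    rw [Fintype.card_of_subtype I.toFinset (by simp [hP]), List.toFinset_card_of_nodup hI]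
  have hin : ∀ v, ∫⁻ u, ENNReal.ofReal (Real.exp (deviation D I R g l κ η (e.symm (u, v))))
      ∂(Measure.pi fun _ : {i // P i} => D) ≤ ENNReal.ofReal ((η ^ d)⁻¹) := by
    intro v
    -- The region ignores the coordinates in I, so they may be filled with an arbitrary point in
    -- order to name it as a fixed set.
    obtain ⟨z0⟩ : Nonempty (Example X) := nonempty_of_isProbabilityMeasure D
    set R' := R (e.symm (fun _ => z0, v)) with hR'
    have hRR : ∀ u, R (e.symm (u, v)) = R' := by
      intro u
      refine hRI _ _ fun i hi => ?_
      simp [he, MeasurableEquiv.piEquivPiSubtypeProd, Equiv.piEquivPiSubtypeProd, hP, hi]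
    have hR'm : MeasurableSet R' := (measurable_const.prodMk measurable_id) hR
    have hval : ∀ u (j : {i // P i}), e.symm (u, v) j = u j := by
      intro u j
      simp [he, MeasurableEquiv.piEquivPiSubtypeProd, Equiv.piEquivPiSubtypeProd, j.2]
    have hgm : Measurable fun p : ({i // P i} → Example X) × X => g (e.symm (p.1, v)) p.2 :=
      hg.comp ((e.symm.measurable.comp (measurable_fst.prodMk measurable_const)).prodMk
        measurable_snd)
    have hmain := lintegral_exp_deviation_le hd D hR'm (g := fun u => g (e.symm (u, v))) hgm (fun u => hgH _) hl hκ hlκ hη hη1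
    set q : ℝ := 2 * η * I.length * D.real R' with hq
    have hcount : ∀ u, (I.countP fun i => decide (e.symm (u, v) i ∈ R' ∧
        g (e.symm (u, v)) (e.symm (u, v) i).1 ≠ (e.symm (u, v) i).2))
        = (Finset.univ.filter fun j : {i // P i} => u j ∈ R' ∧
          g (e.symm (u, v)) (u j).1 ≠ (u j).2).card := by
      intro u
      rw [← List.Nodup.card_eq_countP hI, ← Finset.card_map (Function.Embedding.subtype _)]
      congr 1
      ext i
      simp only [Finset.mem_filter, List.mem_toFinset, Finset.mem_map, Finset.mem_univ, true_and,
        Function.Embedding.subtype_apply, Subtype.exists, exists_and_right, exists_eq_right]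
      constructor
      · rintro ⟨hi, h⟩
        refine ⟨(hP i).2 hi, ?_⟩
        have := hval u ⟨i, (hP i).2 hi⟩
        simp only at this
        rwa [this] at h
      · rintro ⟨hi, h⟩
        refine ⟨(hP i).1 hi, ?_⟩
        have := hval u ⟨i, hi⟩
        simp only at this
        rwa [this]
    have hsplit : ∀ u, ENNReal.ofReal (Real.exp (deviation D I R g l κ η (e.symm (u, v))))
        = ENNReal.ofReal (Real.exp (l * (Fintype.card {i // P i}
            * D.real {z | z ∈ R' ∧ g (e.symm (u, v)) z.1 ≠ z.2}
          - κ * (Finset.univ.filter fun j : {i // P i} =>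
            u j ∈ R' ∧ g (e.symm (u, v)) (u j).1 ≠ (u j).2).card)))
          * ENNReal.ofReal (Real.exp (-q)) := by
      intro u
      rw [← ENNReal.ofReal_mul (Real.exp_pos _).le, ← Real.exp_add, ← hcount, hcard]
      unfold deviation
      rw [hRR u, hq, sub_eq_add_neg]
    rw [lintegral_congr hsplit, lintegral_mul_const' _ _ ENNReal.ofReal_ne_top]
    calc _ ≤ ENNReal.ofReal ((η ^ d)⁻¹ * Real.exp (2 * η * Fintype.card {i // P i} * D.real R'))
          * ENNReal.ofReal (Real.exp (-q)) := by
          gcongr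
      _ = _ := by
          rw [← ENNReal.ofReal_mul (by positivity), hcard, ← hq, mul_assoc, ← Real.exp_add]
          simp
  calc _ ≤ ∫⁻ _v, ENNReal.ofReal ((η ^ d)⁻¹) ∂(Measure.pi fun _ : {i // ¬ P i} => D) :=
        lintegral_mono hin
    _ = _ := by simp

end Lift

/-! ### Combinatorics of the splitting scheme. -/

section Splitting

variable {α β : Type*}

theorem block_sublist (S : List α) (i n : ℕ) : (block S i n).Sublist S :=
  (List.take_sublist _ _).trans (List.drop_sublist _ _)

theorem block_map (f : α → β) (S : List α) (i n : ℕ) :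
    block (S.map f) i n = (block S i n).map f := by
  simp [block, List.map_take, List.map_drop]

theorem length_block {S : List α} {i n q : ℕ} (hS : S.length = q * n) (hi : i < q) :
    (block S i n).length = n := by
  have : (i + 1) * n ≤ q * n := Nat.mul_le_mul_right n hi
  simp only [block, List.length_take, List.length_drop, hS]
  rw [add_mul, one_mul] at this
  omega

theorem disjoint_block {S : List α} (hS : S.Nodup) {i j : ℕ} (hij : i ≠ j) (n : ℕ) :
    List.Disjoint (block S i n) (block S j n) := by
  wlog h : i < j generalizing i j
  · exact (this hij.symm (by omega)).symm
  have h1 : block S i n ⊆ S.take ((i + 1) * n) := by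
    have : block S i n = (S.take ((i + 1) * n)).drop (i * n) := by
      rw [block, add_mul, one_mul, List.drop_take]
      simp
    rw [this]
    exact List.drop_subset _ _
  have h2 : block S j n ⊆ S.drop (j * n) := List.take_subset _ _
  have h3 := List.disjoint_take_drop hS (Nat.mul_le_mul_right n h : (i + 1) * n ≤ j * n)
  exact fun a ha hb => h3 (h1 ha) (h2 hb)

/-- The scheme looks only at positions. It can therefore be applied to lists of indices, whose
disjointness expresses independence, while the examples stay random. -/
theorem splitting_map (f : α → β) (k : ℕ) (S T : List α) :
    splitting k (S.map f) (T.map f) = (splitting k S T).map (List.map f) := by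
  induction k, S, T using splitting.induct with
  | case1 k S T ih =>
    simp only [splitting, List.map_flatMap]
    congr 1
    funext i
    rw [← ih i]
    simp [block_map, List.map_take, List.map_drop]
  | _ => simp [splitting]

theorem sublist_of_mem_splitting {k : ℕ} {S T l : List α} (hl : l ∈ splitting k S T) :
    l.Sublist (S ++ T) := by
  induction k, S, T using splitting.induct with
  | case1 k S T ih =>
    simp only [splitting, List.mem_flatMap] at hl
    obtain ⟨i, -, hi⟩ := hl
    refine (ih i hi).trans ?_
    rw [← List.append_assoc, List.take_append_drop]
    exact (block_sublist _ _ _).append (List.Sublist.refl _)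
  | _ => simp_all [splitting]

/-- Each recursive call only prepends to T. Hence the data handed down to a child is contained in
the training sequence of every member below it. -/
theorem suffix_of_mem_splitting {k : ℕ} {S T l : List α} (hl : l ∈ splitting k S T) :
    T <:+ l := by
  induction k, S, T using splitting.induct with
  | case1 k S T ih =>
    simp only [splitting, List.mem_flatMap] at hl
    obtain ⟨i, -, hi⟩ := hl
    exact (List.suffix_append _ _).trans (ih i hi)
  | _ => simp_all [splitting]

/-- The `r`-th member of the splitting family. -/
def leaf (k : ℕ) (S T : List α) (r : Fin (27 ^ (k / 6))) : List α :=
  (splitting k S T).get (Fin.cast (length_splitting k S T).symm r)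

theorem leaf_mem (k : ℕ) (S T : List α) (r : Fin (27 ^ (k / 6))) :
    leaf k S T r ∈ splitting k S T := List.get_mem _ _

theorem leaf_map (f : α → β) (k : ℕ) (S T : List α) (r : Fin (27 ^ (k / 6))) :
    leaf k (S.map f) (T.map f) r = (leaf k S T r).map f := by
  simp [leaf, splitting_map]

theorem countP_eq_sum_get (F : List α) (p : α → Bool) {M : ℕ} (hM : F.length = M) :
    F.countP p = ∑ r : Fin M, if p (F.get (Fin.cast hM.symm r)) then 1 else 0 := by
  subst hM
  induction F with
  | nil => simp
  | cons a F ih =>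
    rw [List.countP_cons, ih, add_comm]
    exact (Fin.sum_univ_succ (n := F.length)
      (fun r => if p ((a :: F).get r) then (1 : ℕ) else 0)).symm

theorem countP_splitting (k : ℕ) (S T : List α) (p : List α → Bool) :
    (splitting k S T).countP p = ∑ r, if p (leaf k S T r) then 1 else 0 :=
  countP_eq_sum_get _ _ (length_splitting k S T)

end Splitting

/-! ### Empirical errors, measurability and averaged deviation bounds. -/

section Errors

variable {X : Type*} {ι : Type*}

/-- The number of errors of `h` on `S`. -/
def errorsOn (h : X → Bool) (S : List (Example X)) : ℕ := S.countP fun z => h z.1 != z.2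

theorem errorsOn_mono (h : X → Bool) {S S' : List (Example X)} (hS : S.Sublist S') :
    errorsOn h S ≤ errorsOn h S' := hS.countP_le

theorem IsERM.errorsOn_le {H : Set (X → Bool)} {A : Learner X} (hA : IsERM H A)
    (S : List (Example X)) {h : X → Bool} (hh : h ∈ H) : errorsOn (A S) S ≤ errorsOn h S := by
  have := (hA S).2 h hh
  unfold empErr at this
  rcases Nat.eq_zero_or_pos S.length with h0 | h0
  · have : S = [] := List.length_eq_zero_iff.1 h0
    simp [this, errorsOn]
  · rw [div_le_div_iff_of_pos_right (by exact_mod_cast h0)] at this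
    exact_mod_cast this

variable [MeasurableSpace X]

theorem measurable_learner_map {A : Learner X} (hAm : MeasurableLearner A) (l : List ι) :
    Measurable fun p : (ι → Example X) × X => A (l.map p.1) p.2 := by
  have h1 : ∀ ω : ι → Example X, l.map ω = List.ofFn fun j : Fin l.length => ω (l.get j) := by
    intro ω
    apply List.ext_get
    · simp
    · intro n h1 h2
      simp
  simp_rw [h1]
  refine (hAm l.length).comp (Measurable.prodMk ?_ measurable_snd)
  exact measurable_pi_lambda _ fun j => (measurable_pi_apply _).comp measurable_fst

theorem measurableSet_err {Ω : Type*} [MeasurableSpace Ω] {g : Ω → X → Bool}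
    (hg : Measurable fun p : Ω × X => g p.1 p.2) :
    MeasurableSet {q : Ω × Example X | g q.1 q.2.1 ≠ q.2.2} := by
  have h1 : Measurable fun q : Ω × Example X => g q.1 q.2.1 :=
    hg.comp (measurable_fst.prodMk (measurable_fst.comp measurable_snd))
  exact (measurableSet_eq_fun h1 (measurable_snd.comp measurable_snd)).compl

open Classical in
/-- With high probability the average error, inside a region, of data-dependent hypotheses is
controlled by their errors on fresh data. -/
theorem measure_avgErr_ge_le_of_countP_le [Fintype ι] {H : Set (X → Bool)} {d : ℕ}
    (hd : ∀ C : Finset X, Shatters H C → C.card ≤ d) (D : Measure (Example X))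
    [IsProbabilityMeasure D] {ρ : Type*} [Fintype ρ] [Nonempty ρ]
    {g : ρ → (ι → Example X) → X → Bool}
    (hg : ∀ r, Measurable fun p : (ι → Example X) × X => g r p.1 p.2) (hgH : ∀ r ω, g r ω ∈ H)
    {I : ρ → List ι} {n : ℕ} (hI : ∀ r, (I r).Nodup) (hn : ∀ r, (I r).length = n)
    {R : (ι → Example X) → Set (Example X)}
    (hR : MeasurableSet {q : (ι → Example X) × Example X | q.2 ∈ R q.1})
    (hRI : ∀ r, ∀ ω ω' : ι → Example X, (∀ i, i ∉ I r → ω i = ω' i) → R ω = R ω')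
    {N : (ι → Example X) → ℕ}
    (hN : ∀ r ω, ((I r).countP fun i => decide (ω i ∈ R ω ∧ g r ω (ω i).1 ≠ (ω i).2)) ≤ N ω)
    {l κ η δ : ℝ} (hl : 0 < l) (hκ : 1 ≤ κ)
    (hlκ : Real.exp l + Real.exp (-(κ * l)) ≤ 2) (hη : 0 < η) (hη1 : η ≤ 1) (hδ : 0 < δ) :
    (Measure.pi fun _ : ι => D) {ω | κ * N ω + (2 * η * n * D.real (R ω) + d * Real.log (1 / η)
        + Real.log (1 / δ)) / l ≤ n * ((∑ r, D.real {z | z ∈ R ω ∧ g r ω z.1 ≠ z.2})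
          / Fintype.card ρ)} ≤ ENNReal.ofReal δ := by
  have hmain := measure_avg_ge_le (μ := Measure.pi fun _ : ι => D)
    (Y := fun r => deviation D (I r) R (g r) l κ η)
    (fun r => measurable_deviation D (I r) hR (hg r) l κ η) (M := (η ^ d)⁻¹) (by positivity)
    (fun r => lintegral_exp_deviation_le_one hd D (hI r) hR (hRI r) (hg r) (hgH r)
      hl.le hκ hlκ hη hη1) hδ
  refine (measure_mono fun ω hω => ?_).trans hmain
  rw [Set.mem_ofPred_eq] at hω ⊢
  have hcard : (0 : ℝ) < Fintype.card ρ := by exact_mod_cast Fintype.card_pos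
  have hlog : Real.log ((η ^ d)⁻¹ / δ) = d * Real.log (1 / η) + Real.log (1 / δ) := by
    rw [div_eq_mul_one_div, Real.log_mul (by positivity) (by positivity), one_div η, Real.log_inv,
      Real.log_inv, Real.log_pow]
    ring
  have hdev : ∀ r, l * (n * D.real {z | z ∈ R ω ∧ g r ω z.1 ≠ z.2} - κ * N ω)
      - 2 * η * n * D.real (R ω) ≤ deviation D (I r) R (g r) l κ η ω := by
    intro r
    have hc : (((I r).countP fun i => decide (ω i ∈ R ω ∧ g r ω (ω i).1 ≠ (ω i).2) : ℕ) : ℝ)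
        ≤ N ω := by
      exact_mod_cast hN r ω
    unfold deviation
    rw [hn r]
    have := mul_le_mul_of_nonneg_left hc (mul_nonneg hl.le (zero_le_one.trans hκ))
    linarith
  have hsum := Finset.sum_le_sum fun r (_ : r ∈ Finset.univ) => hdev r
  rw [Finset.sum_sub_distrib, ← Finset.mul_sum, Finset.sum_sub_distrib, ← Finset.mul_sum,
    Finset.sum_const, Finset.sum_const, Finset.card_univ, nsmul_eq_mul, nsmul_eq_mul] at hsum
  rw [hlog, le_div_iff₀ hcard]
  refine le_trans ?_ hsum
  rw [← mul_div_assoc, le_div_iff₀ hcard, add_mul, div_mul_eq_mul_div, ← le_sub_iff_add_le',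
    div_le_iff₀ hl] at hω
  linarith

/-- With high probability the average error, inside a region, of learners trained on samples that
extend fresh data is controlled by the errors of a competitor on the training samples. -/
theorem measure_avgErr_ge_le [Fintype ι] {H : Set (X → Bool)} {d : ℕ}
    (hd : ∀ C : Finset X, Shatters H C → C.card ≤ d) {A : Learner X} (hA : IsERM H A)
    (hAm : MeasurableLearner A) (D : Measure (Example X)) [IsProbabilityMeasure D]
    {h₀ : X → Bool} (hh₀ : h₀ ∈ H) {ρ : Type*} [Fintype ρ] [Nonempty ρ] {lf I : ρ → List ι}
    {n : ℕ} (hI : ∀ r, (I r).Nodup) (hn : ∀ r, (I r).length = n) (hIl : ∀ r, (I r).Sublist (lf r))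
    {R : (ι → Example X) → Set (Example X)}
    (hR : MeasurableSet {q : (ι → Example X) × Example X | q.2 ∈ R q.1})
    (hRI : ∀ r, ∀ ω ω' : ι → Example X, (∀ i, i ∉ I r → ω i = ω' i) → R ω = R ω')
    {N : (ι → Example X) → ℕ} (hN : ∀ r ω, errorsOn h₀ ((lf r).map ω) ≤ N ω)
    {l κ η δ : ℝ} (hl : 0 < l) (hκ : 1 ≤ κ)
    (hlκ : Real.exp l + Real.exp (-(κ * l)) ≤ 2) (hη : 0 < η) (hη1 : η ≤ 1) (hδ : 0 < δ) :
    (Measure.pi fun _ : ι => D) {ω | κ * N ω + (2 * η * n * D.real (R ω) + d * Real.log (1 / η)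
        + Real.log (1 / δ)) / l ≤ n * ((∑ r, D.real {z | z ∈ R ω ∧ A ((lf r).map ω) z.1 ≠ z.2})
          / Fintype.card ρ)} ≤ ENNReal.ofReal δ := by
  classical
  refine measure_avgErr_ge_le_of_countP_le hd D (g := fun r ω => A ((lf r).map ω))
    (fun r => measurable_learner_map hAm (lf r)) (fun r ω => (hA _).1) hI hn hR hRI
    (fun r ω => ?_) hl hκ hlκ hη hη1 hδ
  refine le_trans ?_ ((hA.errorsOn_le _ hh₀).trans (hN r ω))
  refine le_trans ?_ (errorsOn_mono _ ((hIl r).map ω))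
  rw [errorsOn, List.countP_map]
  refine List.countP_mono_left fun i _ hi => ?_
  simp only [decide_eq_true_eq] at hi
  simpa using hi.2

end Errors

/-! ### Hard regions and the covering step of the recursion. -/

section Recursion

variable {X : Type*} {ι : Type*}

/-- The number of members of the splitting family whose classifier errs on `z`. -/
def errCount (A : Learner X) (k : ℕ) (S T : List (Example X)) (z : Example X) : ℕ :=
  (splitting k S T).countP fun l => A l z.1 != z.2

theorem errCount_map (A : Learner X) (k : ℕ) (S T : List ι) (ω : ι → Example X) (z : Example X) :
    errCount A k (S.map ω) (T.map ω) z
      = (splitting k S T).countP fun l => A (l.map ω) z.1 != z.2 := by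
  rw [errCount, splitting_map, List.countP_map]
  rfl

theorem errCount_eq_sum (A : Learner X) (k : ℕ) (S T : List (Example X)) (z : Example X) :
    errCount A k S T z = ∑ r, if A (leaf k S T r) z.1 ≠ z.2 then 1 else 0 := by
  rw [errCount, countP_splitting]
  simp

theorem errCount_le (A : Learner X) (k : ℕ) (S T : List (Example X)) (z : Example X) :
    errCount A k S T z ≤ 27 ^ (k / 6) := by
  rw [← length_splitting k S T]
  exact List.countP_le_length

/-- The examples on which at least a `10 / 243` fraction of the splitting family errs. -/
def hardRegion (A : Learner X) (k : ℕ) (S T : List (Example X)) : Set (Example X) :=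
  {z | 10 * 27 ^ (k / 6) ≤ 243 * errCount A k S T z}

theorem errCount_succ (A : Learner X) (k : ℕ) (S T : List (Example X)) (z : Example X) :
    errCount A (k + 6) S T z = ∑ i : Fin 27,
      errCount A k ((block S i (3 ^ (k + 3))).take (3 ^ k))
        ((block S i (3 ^ (k + 3))).drop (3 ^ k) ++ T) z := by
  rw [errCount, splitting, List.countP_flatMap, ← List.map_coe_finRange_eq_range, List.map_map,
    ← Fin.sum_univ_def]
  rfl

theorem measurable_errCount [MeasurableSpace X] {A : Learner X} (hAm : MeasurableLearner A)
    (k : ℕ) (S T : List ι) :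
    Measurable fun q : (ι → Example X) × Example X =>
      errCount A k (S.map q.1) (T.map q.1) q.2 := by
  simp_rw [errCount_map]
  convert measurable_countP (Ω := (ι → Example X) × Example X)
    (p := fun q l => A (l.map q.1) q.2.1 ≠ q.2.2)
    (fun l => measurableSet_err (g := fun ω => A (l.map ω)) (measurable_learner_map hAm l)) (splitting k S T) using 4
  rw [Bool.eq_iff_iff]
  simp

theorem measurableSet_hardRegion [MeasurableSpace X] {A : Learner X} (hAm : MeasurableLearner A)
    (k : ℕ) (S T : List ι) :
    MeasurableSet {q : (ι → Example X) × Example X |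
      q.2 ∈ hardRegion A k (S.map q.1) (T.map q.1)} :=
  measurableSet_le measurable_const ((measurable_errCount hAm k S T).const_mul 243)

/-- If a `10 / 243` fraction of all members errs, then some child has a `10 / 243` fraction of
erring members and the other children still contain many erring members. -/
theorem one_le_sum_of_mem_hardRegion (A : Learner X) (k : ℕ) (S T : List (Example X))
    {z : Example X} (hz : z ∈ hardRegion A (k + 6) S T)
    (F : Fin 27 → List (Example X) × List (Example X))
    (hF : ∀ i : Fin 27, F i = ((block S i (3 ^ (k + 3))).take (3 ^ k),
      (block S i (3 ^ (k + 3))).drop (3 ^ k) ++ T)) :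
    1 ≤ ∑ p : Fin 27 × Fin 27 × Fin (27 ^ (k / 6)),
      (if p.1 ≠ p.2.1 then (9 / 27 ^ (k / 6) : ℝ) else 0) *
        {z | z ∈ hardRegion A k (F p.1).1 (F p.1).2 ∧
          A (leaf k (F p.2.1).1 (F p.2.1).2 p.2.2) z.1 ≠ z.2}.indicator 1 z := by
  classical
  set e : Fin 27 → ℕ := fun i => errCount A k (F i).1 (F i).2 z with he
  set M : ℕ := 27 ^ (k / 6) with hM
  have hMpos : 0 < M := by positivity
  have hsum : 10 * (27 * M) ≤ 243 * ∑ i, e i := by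
    have h1 : (k + 6) / 6 = k / 6 + 1 := by omega
    have h2 : 10 * 27 ^ ((k + 6) / 6) ≤ 243 * errCount A (k + 6) S T z := hz
    rw [errCount_succ, h1, pow_succ, mul_comm (27 ^ (k / 6)) 27] at h2
    simpa [he, hF, hM] using h2
  have hle : ∀ i, e i ≤ M := fun i => errCount_le _ _ _ _ _
  -- Pigeonhole over the 27 children.
  obtain ⟨i, hi⟩ : ∃ i, 10 * M ≤ 243 * e i := by
    by_contra! hcon
    have := Finset.sum_lt_sum_of_nonempty (s := (Finset.univ : Finset (Fin 27)))
      Finset.univ_nonempty (fun i _ => hcon i)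
    rw [← Finset.mul_sum] at this
    simp at this
    omega
  -- The total is at least 270M/243 = 10M/9 and child i accounts for at most M of it, so M/9
  -- remains. This is why the threshold must exceed 9/243 and where the weight 9/M comes from.
  have hrest : M ≤ 9 * ∑ j ∈ Finset.univ.erase i, e j := by
    have h1 := Finset.add_sum_erase Finset.univ e (Finset.mem_univ i)
    have h2 := hle i
    omega
  have hnn : ∀ p : Fin 27 × Fin 27 × Fin M, 0 ≤
      (if p.1 ≠ p.2.1 then (9 / 27 ^ (k / 6) : ℝ) else 0) *
        {z | z ∈ hardRegion A k (F p.1).1 (F p.1).2 ∧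
          A (leaf k (F p.2.1).1 (F p.2.1).2 p.2.2) z.1 ≠ z.2}.indicator 1 z := by
    intro p
    refine mul_nonneg (by split_ifs <;> positivity) (Set.indicator_nonneg (by simp) _)
  rw [Fintype.sum_prod_type]
  refine le_trans ?_ (Finset.single_le_sum (fun i _ => Finset.sum_nonneg fun q _ => hnn (i, q))
    (Finset.mem_univ i))
  rw [Fintype.sum_prod_type]
  have hi' : z ∈ hardRegion A k (F i).1 (F i).2 := hi
  have hinner : ∀ j ∈ Finset.univ.erase i, ∑ r : Fin M,
      (if i ≠ j then (9 / 27 ^ (k / 6) : ℝ) else 0) *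
        {z | z ∈ hardRegion A k (F i).1 (F i).2 ∧
          A (leaf k (F j).1 (F j).2 r) z.1 ≠ z.2}.indicator 1 z = 9 / M * e j := by
    intro j hj
    have hij : i ≠ j := (Finset.ne_of_mem_erase hj).symm
    rw [if_pos hij, ← Finset.mul_sum, he]
    simp only [hM]
    rw [errCount_eq_sum]
    push_cast
    congr 1
    refine Finset.sum_congr rfl fun r _ => ?_
    simp [Set.indicator_apply, hi']
  calc (1 : ℝ) ≤ ∑ j ∈ Finset.univ.erase i, 9 / (M : ℝ) * e j := by
        rw [← Finset.mul_sum, div_mul_eq_mul_div, le_div_iff₀ (by exact_mod_cast hMpos), one_mul]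
        exact_mod_cast hrest
    _ = _ := (Finset.sum_congr rfl hinner).symm
    _ ≤ _ := Finset.sum_le_sum_of_subset_of_nonneg (Finset.subset_univ _)
        fun j _ _ => Finset.sum_nonneg fun r _ => hnn (i, j, r)

end Recursion

/-! ### The mass of the hard region. -/

section RecursionBound

variable {X : Type*} {ι : Type*}

theorem log_div_le_of_pos {δ b : ℝ} (hδ : 0 < δ) (hb : 0 < b) :
    Real.log (1 / (δ / b)) = Real.log b + Real.log (1 / δ) := by
  rw [← Real.log_mul hb.ne' (by positivity)]
  congr 1
  field_simp

theorem log_thousand_le : Real.log 1000 ≤ 7 := by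
  calc Real.log 1000 ≤ Real.log (2 ^ 10) := Real.log_le_log (by norm_num) (by norm_num)
    _ = 10 * Real.log 2 := by rw [Real.log_pow]; norm_num
    _ ≤ 7 := by linarith [Real.log_two_lt_d9]

/-- By the quadratic bound on the exponential, l(1 + κ²) ≤ κ - 1 suffices. The crude choice κ = 2, l
= 1/8 is enough here because the recursion only needs some constant. -/
theorem exp_eighth_add_le : Real.exp (1 / 8) + Real.exp (-(2 * (1 / 8))) ≤ 2 := by
  have h1 : Real.exp (1 / 8) ≤ 1 + 1 / 8 + (1 / 8) ^ 2 :=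
    exp_le_one_add_add_sq (by norm_num [abs_of_pos])
  have h2 : Real.exp (-(2 * (1 / 8))) ≤ 1 + -(2 * (1 / 8)) + (-(2 * (1 / 8))) ^ 2 :=
    exp_le_one_add_add_sq (by norm_num [abs_of_neg])
  norm_num at h1 h2 ⊢
  linarith

theorem hardRegion_congr (A : Learner X) (k : ℕ) (S T : List ι) {ω ω' : ι → Example X}
    (h : ∀ i ∈ S ++ T, ω i = ω' i) :
    hardRegion A k (S.map ω) (T.map ω) = hardRegion A k (S.map ω') (T.map ω') := by
  have hS : S.map ω = S.map ω' := List.map_congr_left fun i hi => h i (by simp [hi])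
  have hT : T.map ω = T.map ω' := List.map_congr_left fun i hi => h i (by simp [hi])
  rw [hS, hT]

/-- The arithmetic of one step of the recursion. -/
theorem recursion_step_arith {N d ℓ P p a : ℝ} (hN : 0 ≤ N) (hd : 0 ≤ d) (hℓ : 1 ≤ ℓ)
    (hp : a * p ≤ 10 ^ 8 * (N + d + (7 + ℓ)))
    (hP : 26 * a * P ≤ 2 * N + (2 * (1 / (52 * 10 ^ 8)) * (26 * a) * p
      + d * 23 + (6 + ℓ)) / (1 / 8)) :
    a * P ≤ 8 * (N + d + ℓ) := by
  -- The value η = 1/(52·10^8) is chosen so that the factor 10^8 from the previous level cancels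
  -- exactly.
  have h1 : 2 * (1 / (52 * 10 ^ 8)) * (26 * a) * p ≤ N + d + (7 + ℓ) := by
    have : 2 * (1 / (52 * 10 ^ 8)) * (26 * a) * p = (a * p) / 10 ^ 8 := by ring
    rw [this, div_le_iff₀ (by norm_num)]
    linarith
  have h2 : 26 * a * P ≤ 2 * N + 8 * (N + d + (7 + ℓ) + d * 23 + (6 + ℓ)) := by
    refine hP.trans ?_
    rw [div_div_eq_mul_div, div_one]
    linarith
  nlinarith

theorem log_const_le : Real.log (1 / (1 / (52 * 10 ^ 8))) ≤ 23 := by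
  calc Real.log (1 / (1 / (52 * 10 ^ 8))) ≤ Real.log (2 ^ 33) :=
        Real.log_le_log (by norm_num) (by norm_num)
    _ = 33 * Real.log 2 := by rw [Real.log_pow]; norm_num
    _ ≤ 23 := by linarith [Real.log_two_lt_d9]

/-- High-probability bound for the mass of the region where a `10 / 243` fraction of the splitting
family errs. -/
theorem measure_hardRegion_gt_le [MeasurableSpace X] [Fintype ι] {H : Set (X → Bool)} {d : ℕ}
    (hd : ∀ C : Finset X, Shatters H C → C.card ≤ d) {A : Learner X} (hA : IsERM H A)
    (hAm : MeasurableLearner A) (D : Measure (Example X)) [IsProbabilityMeasure D]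
    {h₀ : X → Bool} (hh₀ : h₀ ∈ H) (k : ℕ) :
    ∀ L T : List ι, L.length = 3 ^ k → (L ++ T).Nodup → ∀ δ : ℝ, 0 < δ → δ ≤ 1 →
    (Measure.pi fun _ : ι => D) {ω | 10 ^ 8 * (errorsOn h₀ ((L ++ T).map ω) + d
        + (1 + Real.log (1 / δ))) < 3 ^ k * D.real (hardRegion A k (L.map ω) (T.map ω))}
      ≤ ENNReal.ofReal δ := by
  induction k using Nat.strong_induction_on with
  | _ k ih =>
  intro L T hL hLT δ hδ hδ1
  have hℓ0 : 0 ≤ Real.log (1 / δ) := Real.log_nonneg (by rw [le_div_iff₀ hδ]; linarith)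
  rcases Nat.lt_or_ge k 6 with hk | hk
  -- Below k = 6 the claim is trivial, because 3^k ≤ 10^8.
  · refine le_of_eq_of_le (measure_mono_null (t := ∅) (fun ω hω => ?_) measure_empty) zero_le
    revert hω
    simp only [Set.mem_ofPred_eq, Set.mem_empty_iff_false, imp_false, not_lt]
    have h1 : D.real (hardRegion A k (L.map ω) (T.map ω)) ≤ 1 := measureReal_le_one
    have h2 : (3 : ℝ) ^ k ≤ 3 ^ 6 := pow_le_pow_right₀ (by norm_num) hk.le
    have h3 : (0 : ℝ) ≤ errorsOn h₀ ((L ++ T).map ω) := Nat.cast_nonneg _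
    have h4 : (0 : ℝ) ≤ d := Nat.cast_nonneg _
    calc _ ≤ (3 : ℝ) ^ k * 1 := by gcongr
      _ ≤ 10 ^ 8 * 1 := by norm_num at h2 ⊢; linarith
      _ ≤ _ := by gcongr; linarith
  obtain ⟨k, rfl⟩ := Nat.exists_eq_add_of_le' hk
  set B : Fin 27 → List ι := fun i => block L i (3 ^ (k + 3)) with hB
  set U : Fin 27 → List ι := fun i => (B i).take (3 ^ k) with hU
  set V : Fin 27 → List ι := fun i => (B i).drop (3 ^ k) with hV
  have hUV : ∀ i, U i ++ (V i ++ T) = B i ++ T := fun i => by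
    rw [← List.append_assoc, hU, hV, List.take_append_drop]
  have hBsub : ∀ i, (B i).Sublist L := fun i => block_sublist _ _ _
  have hBlen : ∀ i, (B i).length = 3 ^ (k + 3) := fun i =>
    length_block (q := 27) (by rw [hL]; ring) i.2
  have hUlen : ∀ i, (U i).length = 3 ^ k := fun i => by
    rw [hU, List.length_take, hBlen, min_eq_left (Nat.pow_le_pow_right (by norm_num) (by omega))]
  have hVlen : ∀ i, (V i).length = 26 * 3 ^ k := fun i => by
    rw [hV, List.length_drop, hBlen, pow_add]
    omega
  have hLnd : L.Nodup := hLT.of_append_left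
  have hLTd : List.Disjoint L T := List.disjoint_of_nodup_append hLT
  have hBT : ∀ i, (B i ++ T).Sublist (L ++ T) := fun i =>
    (hBsub i).append (List.Sublist.refl _)
  have hVB : ∀ i, (V i).Sublist (B i) := fun i => List.drop_sublist _ _
  have hVdisj : ∀ i j, i ≠ j → ∀ a ∈ B i ++ T, a ∉ V j := by
    intro i j hij a ha hj
    have haj : a ∈ B j := (hVB j).subset hj
    rcases List.mem_append.1 ha with h | h
    · exact disjoint_block hLnd (fun h => hij (Fin.ext h)) _ h haj
    · exact hLTd ((hBsub j).subset haj) h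
  set R : Fin 27 → (ι → Example X) → Set (Example X) := fun i ω =>
    hardRegion A k ((U i).map ω) ((V i ++ T).map ω) with hR
  set lf : Fin 27 → Fin (27 ^ (k / 6)) → List ι := fun j r => leaf k (U j) (V j ++ T) r with hlf
  set P : Fin 27 → Fin 27 → (ι → Example X) → ℝ := fun i j ω =>
    (∑ r, D.real {z | z ∈ R i ω ∧ A ((lf j r).map ω) z.1 ≠ z.2})
      / Fintype.card (Fin (27 ^ (k / 6))) with hP
  set N : (ι → Example X) → ℕ := fun ω => errorsOn h₀ ((L ++ T).map ω) with hN
  have hδ' : 0 < δ / 1000 := by positivity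
  have hE1 : ∀ i, (Measure.pi fun _ : ι => D) {ω | 10 ^ 8 * ((errorsOn h₀
      ((U i ++ (V i ++ T)).map ω) : ℝ) + d + (1 + Real.log (1 / (δ / 1000))))
        < 3 ^ k * D.real (R i ω)} ≤ ENNReal.ofReal (δ / 1000) := by
    intro i
    refine ih k (by omega) (U i) (V i ++ T) (hUlen i) ?_ _ hδ' (by linarith)
    rw [hUV]
    exact (hBT i).nodup hLT
  have : Nonempty (Fin (27 ^ (k / 6))) := ⟨⟨0, by positivity⟩⟩
  -- For i ≠ j the list `V j` is disjoint from all data determining `R i`, yet is contained in every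
  -- member of child j: it is fresh data for the region and training data for the learner.
  have hE2 : ∀ i j, i ≠ j → (Measure.pi fun _ : ι => D) {ω | 2 * N ω
      + (2 * (1 / (52 * 10 ^ 8)) * ((26 * 3 ^ k : ℕ) : ℝ) * D.real (R i ω)
        + d * Real.log (1 / (1 / (52 * 10 ^ 8))) + Real.log (1 / (δ / 1000))) / (1 / 8)
      ≤ ((26 * 3 ^ k : ℕ) : ℝ) * P i j ω} ≤ ENNReal.ofReal (δ / 1000) := by
    intro i j hij
    refine measure_avgErr_ge_le hd hA hAm D hh₀ (lf := lf j) (I := fun _ => V j)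
      (n := 26 * 3 ^ k) (fun _ => ((hVB j).trans (hBsub j)).nodup hLnd) (fun _ => hVlen j)
      (fun r => ?_) (R := R i) (measurableSet_hardRegion hAm k (U i) (V i ++ T))
      (fun _ ω ω' hω => ?_) (N := N) (fun r ω => ?_) (by norm_num) (by norm_num)
      exp_eighth_add_le (by norm_num) (by norm_num) hδ'
    · exact (List.sublist_append_left _ _).trans (suffix_of_mem_splitting (leaf_mem _ _ _ r)).sublist
    · refine hardRegion_congr A k _ _ fun a ha => hω a ?_
      rw [hUV] at ha
      exact hVdisj i j hij a ha
    · refine errorsOn_mono h₀ (List.Sublist.map _ ?_)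
      have := sublist_of_mem_splitting (leaf_mem k (U j) (V j ++ T) r)
      rw [hUV] at this
      exact this.trans (hBT j)
  set E1 : Fin 27 → Set (ι → Example X) := fun i => {ω | 10 ^ 8 * ((errorsOn h₀
      ((U i ++ (V i ++ T)).map ω) : ℝ) + d + (1 + Real.log (1 / (δ / 1000))))
        < 3 ^ k * D.real (R i ω)} with hE1def
  set E2 : Fin 27 × Fin 27 → Set (ι → Example X) := fun p => {ω | p.1 ≠ p.2 ∧ 2 * N ω
      + (2 * (1 / (52 * 10 ^ 8)) * ((26 * 3 ^ k : ℕ) : ℝ) * D.real (R p.1 ω)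
        + d * Real.log (1 / (1 / (52 * 10 ^ 8))) + Real.log (1 / (δ / 1000))) / (1 / 8)
      ≤ ((26 * 3 ^ k : ℕ) : ℝ) * P p.1 p.2 ω} with hE2def
  have hE2' : ∀ p, (Measure.pi fun _ : ι => D) (E2 p) ≤ ENNReal.ofReal (δ / 1000) := by
    intro p
    by_cases hp : p.1 = p.2
    · have : E2 p = ∅ := by
        ext ω
        simp [hE2def, hp]
      rw [this, measure_empty]
      exact zero_le
    · exact (measure_mono fun ω hω => hω.2).trans (hE2 p.1 p.2 hp)
  have hunion : (Measure.pi fun _ : ι => D) ((⋃ i, E1 i) ∪ ⋃ p, E2 p) ≤ ENNReal.ofReal δ := by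
    calc _ ≤ ∑ i, (Measure.pi fun _ : ι => D) (E1 i) + ∑ p, (Measure.pi fun _ : ι => D) (E2 p) :=
          (measure_union_le _ _).trans (add_le_add (measure_iUnion_fintype_le _ _)
            (measure_iUnion_fintype_le _ _))
      _ ≤ ∑ _i : Fin 27, ENNReal.ofReal (δ / 1000)
          + ∑ _p : Fin 27 × Fin 27, ENNReal.ofReal (δ / 1000) :=
          add_le_add (Finset.sum_le_sum fun i _ => hE1 i) (Finset.sum_le_sum fun p _ => hE2' p)
      -- 27 recursive events and 27² pair events. The loss of log 1000 per level does not
      -- accumulate, since the mass from the lower level is damped by η.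
      _ = ENNReal.ofReal (756 * (δ / 1000)) := by
          rw [ENNReal.ofReal_mul (by norm_num)]
          simp only [Finset.sum_const, Finset.card_univ, Fintype.card_fin, Fintype.card_prod,
            nsmul_eq_mul, ← add_mul]
          norm_num
      _ ≤ _ := ENNReal.ofReal_le_ofReal (by linarith)
  refine (measure_mono fun ω hω => ?_).trans hunion
  by_contra hcon
  simp only [Set.mem_union, Set.mem_iUnion, not_or, not_exists] at hcon
  obtain ⟨hc1, hc2⟩ := hcon
  revert hω
  simp only [Set.mem_ofPred_eq, imp_false, not_lt]
  have hN0 : (0 : ℝ) ≤ N ω := Nat.cast_nonneg _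
  have hd0 : (0 : ℝ) ≤ d := Nat.cast_nonneg _
  have ha : (0 : ℝ) < 3 ^ k := by positivity
  set Q : ℝ := N ω + d + (1 + Real.log (1 / δ)) with hQ
  have hℓ' : Real.log (1 / (δ / 1000)) ≤ 7 + Real.log (1 / δ) := by
    rw [log_div_le_of_pos hδ (by norm_num)]
    linarith [log_thousand_le]
  have hPb : ∀ i j, i ≠ j → 3 ^ k * P i j ω ≤ 8 * Q := by
    intro i j hij
    have h1 := hc1 i
    have h2 := hc2 (i, j)
    simp only [hE1def, hE2def, Set.mem_ofPred_eq, not_lt, not_and, not_le] at h1 h2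
    have h2 := (h2 hij).le
    have hNi : (errorsOn h₀ ((U i ++ (V i ++ T)).map ω) : ℝ) ≤ N ω := by
      rw [hUV]
      exact_mod_cast errorsOn_mono h₀ ((hBT i).map ω)
    refine recursion_step_arith (p := D.real (R i ω)) hN0 hd0 (by linarith) ?_ ?_
    · refine h1.trans (mul_le_mul_of_nonneg_left ?_ (by norm_num))
      linarith
    · push_cast at h2
      refine h2.trans ?_
      gcongr
      · exact log_const_le
      · linarith
  have hcover : D.real (hardRegion A (k + 6) (L.map ω) (T.map ω)) ≤ ∑ i, ∑ j,
      if i ≠ j then 9 * P i j ω else 0 := by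
    have hcov := measureReal_le_sum_of_cover D
      (Finset.univ : Finset (Fin 27 × Fin 27 × Fin (27 ^ (k / 6))))
      (B := fun p => {z | z ∈ R p.1 ω ∧ A ((lf p.2.1 p.2.2).map ω) z.1 ≠ z.2})
      (fun p _ => (measurable_const.prodMk measurable_id)
        (measurableSet_errors (measurableSet_hardRegion hAm k (U p.1) (V p.1 ++ T))
          (g := fun ω => A ((lf p.2.1 p.2.2).map ω)) (measurable_learner_map hAm _)))
      (w := fun p => if p.1 ≠ p.2.1 then (9 / 27 ^ (k / 6) : ℝ) else 0)
      (fun p _ => by split_ifs <;> positivity)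
      (E := hardRegion A (k + 6) (L.map ω) (T.map ω)) (fun z hz => by
        have := one_le_sum_of_mem_hardRegion A k _ _ hz
          (fun i => ((U i).map ω, (V i ++ T).map ω)) (fun i => by
            simp [hU, hV, hB, block_map, List.map_take, List.map_drop])
        simpa only [leaf_map] using this)
    refine hcov.trans (le_of_eq ?_)
    rw [Fintype.sum_prod_type]
    refine Finset.sum_congr rfl fun i _ => ?_
    rw [Fintype.sum_prod_type]
    refine Finset.sum_congr rfl fun j _ => ?_
    by_cases hij : i = j
    · simp [hij]
    · simp only [ne_eq, hij, not_false_eq_true, if_true, hP, Fintype.card_fin]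
      rw [← Finset.mul_sum]
      push_cast
      ring
  have hfin : 3 ^ k * D.real (hardRegion A (k + 6) (L.map ω) (T.map ω)) ≤ 729 * (9 * (8 * Q)) := by
    have hQ0 : 0 ≤ Q := by linarith
    calc _ ≤ 3 ^ k * ∑ i : Fin 27, ∑ j : Fin 27, if i ≠ j then 9 * P i j ω else 0 := by gcongr
      _ = ∑ i : Fin 27, ∑ j : Fin 27, 3 ^ k * (if i ≠ j then 9 * P i j ω else 0) := by
          simp only [Finset.mul_sum]
      _ ≤ ∑ i : Fin 27, ∑ j : Fin 27, 9 * (8 * Q) := by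
          refine Finset.sum_le_sum fun i _ => Finset.sum_le_sum fun j _ => ?_
          split_ifs with hij
          · linarith [hPb i j hij]
          · rw [mul_zero]
            positivity
      _ = _ := by
          simp only [Finset.sum_const, Finset.card_univ, Fintype.card_fin, nsmul_eq_mul]
          ring
  rw [pow_add]
  have hQ0 : 0 ≤ Q := by linarith
  calc (3 : ℝ) ^ k * 3 ^ 6 * D.real (hardRegion A (k + 6) (L.map ω) (T.map ω))
      = 3 ^ 6 * (3 ^ k * D.real (hardRegion A (k + 6) (L.map ω) (T.map ω))) := by ring
    _ ≤ 3 ^ 6 * (729 * (9 * (8 * Q))) := by gcongr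
    -- The product 729 · 729 · 9 · 8 is below 4 · 10^7, which closes the induction with the same
    -- constant.
    _ ≤ 10 ^ 8 * Q := by nlinarith

end RecursionBound

/-! ### Tail bounds and product measures. -/

section Tails

open Classical in
/-- Chernoff bound for the number of hits of a fixed set. -/
theorem measure_countP_ge_le {ι Z : Type*} [Fintype ι] [MeasurableSpace Z] (D : Measure Z)
    [IsProbabilityMeasure D] {E : Set Z} (hE : MeasurableSet E) {I : List ι} (hI : I.Nodup)
    {l κ δ : ℝ} (hl : 0 < l) (hlκ : Real.exp l ≤ 1 + κ * l) (hδ : 0 < δ) :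
    (Measure.pi fun _ : ι => D) {ω | κ * (I.length * D.real E) + Real.log (1 / δ) / l
      ≤ I.countP fun i => decide (ω i ∈ E)} ≤ ENNReal.ofReal δ := by
  have hc : Measurable fun ω : ι → Z => ((I.countP fun i => decide (ω i ∈ E) : ℕ) : ℝ) :=
    (Measurable.of_discrete (f := fun n : ℕ => (n : ℝ))).comp
      (measurable_countP (p := fun (ω : ι → Z) i => ω i ∈ E)
        (fun i => (measurable_pi_apply i) hE) I)
  have h := measure_avg_ge_le (μ := Measure.pi fun _ : ι => D) (ρ := Unit)
    (Y := fun _ ω => l * (I.countP fun i => decide (ω i ∈ E)) - κ * l * (I.length * D.real E))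
    (fun _ => (hc.const_mul l).sub_const _) one_pos
    (fun _ => lintegral_exp_countP_le D hE hI hlκ) hδ
  refine (measure_mono fun ω hω => ?_).trans h
  simp only [Set.mem_ofPred_eq, Finset.univ_unique, Finset.sum_const, Finset.card_singleton,
    one_smul, Fintype.card_unit, Nat.cast_one, div_one] at hω ⊢
  rw [← le_sub_iff_add_le', div_le_iff₀ hl] at hω
  linarith

/-- A bound valid for every value of a discrete variable holds for the product measure. -/
theorem prod_measure_le_of_forall {Ω I : Type*} [MeasurableSpace Ω] [MeasurableSpace I] [Countable I]
    [MeasurableSingletonClass I] (μ : Measure Ω) [IsProbabilityMeasure μ] (ν : Measure I)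
    [IsProbabilityMeasure ν] {B : I → Set Ω} {ε : ℝ≥0∞} (hB : ∀ i, μ (B i) ≤ ε) :
    (μ.prod ν) {p | p.1 ∈ B p.2} ≤ ε := by
  -- The sets `B i` need not be measurable. With countably many fibres, each can be replaced by a
  -- measurable hull of the same measure.
  have hm : MeasurableSet {p : Ω × I | p.1 ∈ toMeasurable μ (B p.2)} := by
    have : {p : Ω × I | p.1 ∈ toMeasurable μ (B p.2)}
        = ⋃ i, (toMeasurable μ (B i)) ×ˢ ({i} : Set I) := by
      ext ⟨ω, i⟩
      simp
    rw [this]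
    exact MeasurableSet.iUnion fun i =>
      (measurableSet_toMeasurable _ _).prod (measurableSet_singleton i)
  calc _ ≤ (μ.prod ν) {p : Ω × I | p.1 ∈ toMeasurable μ (B p.2)} :=
        measure_mono fun p hp => subset_toMeasurable _ _ hp
    _ = ∫⁻ i, μ (toMeasurable μ (B i)) ∂ν := Measure.prod_apply_symm hm
    _ ≤ ∫⁻ _i, ε ∂ν := lintegral_mono fun i => by
        rw [measure_toMeasurable]
        exact hB i
    _ = ε := by simp

/-- If every point lies in a random region with small probability, then the region has small mass
with high probability. -/
theorem prod_measure_fiber_ge_le {Ω I Z : Type*} [MeasurableSpace Ω] [MeasurableSpace I]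
    [MeasurableSpace Z] (μ : Measure Ω) [IsProbabilityMeasure μ] (ν : Measure I)
    [IsProbabilityMeasure ν] (D : Measure Z) [IsProbabilityMeasure D] {s : Set ((Ω × I) × Z)}
    (hs : MeasurableSet s) {ε δ : ℝ} (hε : 0 < ε) (hδ : 0 < δ)
    (h : ∀ ω z, ν {i | ((ω, i), z) ∈ s} ≤ ENNReal.ofReal ε) :
    (μ.prod ν) {p | ε / δ ≤ D.real {z | (p, z) ∈ s}} ≤ ENNReal.ofReal δ := by
  have hm : Measurable fun p : Ω × I => D {z | (p, z) ∈ s} := measurable_measure_prodMk_left hs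
  have hInt : ∫⁻ p, D {z | (p, z) ∈ s} ∂(μ.prod ν) ≤ ENNReal.ofReal ε := by
    rw [lintegral_prod _ hm.aemeasurable]
    calc _ ≤ ∫⁻ _ω, ENNReal.ofReal ε ∂μ := by
          refine lintegral_mono fun ω => ?_
          have hsω : MeasurableSet {q : I × Z | ((ω, q.1), q.2) ∈ s} := by
            have : Measurable fun q : I × Z => ((ω, q.1), q.2) := by fun_prop
            exact this hs
          have e1 := Measure.prod_apply (μ := ν) (ν := D) hsω
          have e2 := Measure.prod_apply_symm (μ := ν) (ν := D) hsω
          calc _ = ∫⁻ z, ν ((fun i => (i, z)) ⁻¹' {q : I × Z | ((ω, q.1), q.2) ∈ s}) ∂D := by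
                rw [← e2, e1]
                rfl
            _ ≤ ∫⁻ _z, ENNReal.ofReal ε ∂D := lintegral_mono fun z => h ω z
            _ = _ := by simp
      _ = _ := by simp
  have hεδ : 0 < ε / δ := by positivity
  calc _ ≤ (μ.prod ν) {p | ENNReal.ofReal (ε / δ) ≤ D {z | (p, z) ∈ s}} := by
        refine measure_mono fun p hp => ?_
        exact ENNReal.ofReal_le_of_le_toReal hp
    _ ≤ _ := meas_ge_le_lintegral_div hm.aemeasurable (by simpa using hεδ) ENNReal.ofReal_ne_top
    _ ≤ ENNReal.ofReal ε / ENNReal.ofReal (ε / δ) := by gcongr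
    _ = ENNReal.ofReal δ := by
        rw [← ENNReal.ofReal_div_of_pos hεδ]
        congr 1
        field_simp

/-- Subadditivity suffices, so the success event need not be shown measurable. -/
theorem one_sub_le_measureReal {Ω : Type*} [MeasurableSpace Ω] (μ : Measure Ω)
    [IsProbabilityMeasure μ] {s : Set Ω} {δ : ℝ} (hδ : 0 ≤ δ) (h : μ sᶜ ≤ ENNReal.ofReal δ) :
    1 - δ ≤ μ.real s := by
  have h1 : μ.real sᶜ ≤ δ := ENNReal.toReal_le_of_le_ofReal hδ h
  have h2 : μ.real (s ∪ sᶜ) ≤ μ.real s + μ.real sᶜ := measureReal_union_le _ _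
  rw [Set.union_compl_self, probReal_univ] at h2
  linarith

end Tails

/-! ### Sampling voters from the splitting family. -/

section Sampling

variable {X : Type*} {ι : Type*}

instance (k t : ℕ) : IsProbabilityMeasure (draws k t) := by
  unfold draws
  infer_instance

theorem voters_apply (A : Learner X) (k : ℕ) (S : List (Example X)) {t : ℕ}
    (i : Fin t → Fin (27 ^ (k / 6))) (j : Fin t) : voters A k S i j = A (leaf k S [] (i j)) := rfl

theorem voters_map (A : Learner X) (k : ℕ) (S : List ι) (ω : ι → Example X) {t : ℕ}
    (i : Fin t → Fin (27 ^ (k / 6))) (j : Fin t) :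
    voters A k (S.map ω) i j = A ((leaf k S [] (i j)).map ω) := by
  rw [voters_apply, ← leaf_map, List.map_nil]

theorem avgNe_eq_sum {t : ℕ} (v : Fin t → X → Bool) (x : X) (y : Bool) :
    avgNe v x y = (∑ j, if v j x ≠ y then (1 : ℝ) else 0) / t := by
  rw [avgNe, Finset.card_filter]
  push_cast
  rfl

theorem avgNe_add_avgEq {t : ℕ} (ht : 0 < t) (v : Fin t → X → Bool) (x : X) (y : Bool) :
    avgNe v x y + avgEq v x y = 1 := by
  have h := Finset.card_filter_add_card_filter_not (s := (Finset.univ : Finset (Fin t)))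
    (fun j => v j x = y)
  rw [Finset.card_univ, Fintype.card_fin] at h
  have ht' : (t : ℝ) ≠ 0 := by exact_mod_cast ht.ne'
  rw [avgNe, avgEq, ← add_div, div_eq_one_iff_eq ht', add_comm]
  exact_mod_cast h

theorem avgEq_not (t : ℕ) (v : Fin t → X → Bool) (x : X) (y : Bool) :
    avgEq v x (!y) = avgNe v x y := by
  simp [avgEq, avgNe, Bool.eq_not]

theorem measurable_avgNe_voters [MeasurableSpace X] {A : Learner X} (hAm : MeasurableLearner A) (k : ℕ) (S : List ι)
    {t : ℕ} (i : Fin t → Fin (27 ^ (k / 6))) :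
    Measurable fun q : (ι → Example X) × Example X =>
      avgNe (voters A k (S.map q.1) i) q.2.1 q.2.2 := by
  simp_rw [avgNe_eq_sum, voters_map]
  refine Measurable.div_const (Finset.measurable_sum _ fun j _ => ?_) _
  exact Measurable.ite (measurableSet_err (g := fun ω => A ((leaf k S [] (i j)).map ω))
    (measurable_learner_map hAm _)) measurable_const measurable_const

/-- The bound 1 + l + l² equals 1 + κl exactly when κ = 1 + l. -/
theorem exp_twentieth_le : Real.exp (1 / 20) ≤ 1 + 21 / 20 * (1 / 20) := by
  have := exp_le_one_add_add_sq (x := 1 / 20) (by norm_num [abs_of_pos])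
  norm_num at this ⊢
  linarith

/-- Outside the hard region, sampled voters rarely have an error fraction of `11 / 243`. -/
theorem draws_avgNe_ge_le (A : Learner X) (k t : ℕ) (S : List (Example X)) {z : Example X}
    (hz : z ∉ hardRegion A k S []) :
    draws k t {i | 11 / 243 ≤ avgNe (voters A k S i) z.1 z.2}
      ≤ ENNReal.ofReal (Real.exp (-(t / 9720))) := by
  classical
  obtain ⟨E, hE⟩ : ∃ E : Set (Fin (27 ^ (k / 6))), ∀ r, r ∈ E ↔ A (leaf k S [] r) z.1 ≠ z.2 :=
    ⟨{r | A (leaf k S [] r) z.1 ≠ z.2}, fun _ => Iff.rfl⟩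
  set U := (PMF.uniformOfFintype (Fin (27 ^ (k / 6)))).toMeasure with hU
  have hMpos : (0 : ℝ) < (27 : ℝ) ^ (k / 6) := by positivity
  have hp : U.real E ≤ 10 / 243 := by
    have h1 : U.real E = errCount A k S [] z / 27 ^ (k / 6) := by
      rw [hU, measureReal_def, PMF.toMeasure_uniformOfFintype_apply _ (Set.toFinite E).measurableSet,
        errCount_eq_sum, ← Finset.card_filter, Fintype.card_subtype]
      simp_rw [hE]
      simp
    have h2 : ¬ 10 * 27 ^ (k / 6) ≤ 243 * errCount A k S [] z := hz
    have h3 : (243 * errCount A k S [] z : ℝ) ≤ 10 * 27 ^ (k / 6) := by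
      exact_mod_cast (not_le.1 h2).le
    rw [h1, div_le_div_iff₀ hMpos (by norm_num)]
    linarith
  have h := measure_countP_ge_le (ι := Fin t) U (Set.toFinite E).measurableSet
    (List.nodup_finRange t) (l := 1 / 20) (κ := 21 / 20) (δ := Real.exp (-(t / 9720)))
    (by norm_num) exp_twentieth_le (Real.exp_pos _)
  refine (measure_mono fun i hi => ?_).trans h
  simp only [Set.mem_ofPred_eq, List.length_finRange] at hi ⊢
  -- With no voters the fraction is 0/0 = 0, so the event is empty.
  rcases Nat.eq_zero_or_pos t with ht | ht
  · subst ht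
    norm_num [avgNe] at hi
  have ht' : (0 : ℝ) < t := by exact_mod_cast ht
  rw [avgNe, le_div_iff₀ ht'] at hi
  have hcount : ((List.finRange t).countP fun j => decide (i j ∈ E))
      = (Finset.univ.filter fun j => voters A k S i j z.1 ≠ z.2).card := by
    rw [← List.Nodup.card_eq_countP (List.nodup_finRange t)]
    congr 1
    ext j
    rw [Finset.mem_filter, Finset.mem_filter]
    simp [hE, voters_apply]
  -- The rate 9720 comes from (21/20)(10/243) + 20/9720 = 10.5/243 + 0.5/243 = 11/243.
  rw [hcount, one_div, ← Real.exp_neg, neg_neg, Real.log_exp]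
  refine le_trans ?_ hi
  have := mul_le_mul_of_nonneg_left hp ht'.le
  linarith

end Sampling

/-! ### Errors and measurability of the tie-breaking classifier. -/

section TieBreaking

variable {X : Type*} {ι : Type*}

open Classical in
theorem measurableSet_filter_eq {Ω : Type*} [MeasurableSpace Ω] {p : Ω → ι → Prop}
    (hp : ∀ i, MeasurableSet {ω | p ω i}) (L l : List ι) :
    MeasurableSet {ω | (L.filter fun i => decide (p ω i)) = l} := by
  induction L generalizing l with
  | nil => simp
  | cons a L ih =>
    have h : {ω | ((a :: L).filter fun i => decide (p ω i)) = l}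
        = ({ω | p ω a} ∩ {ω | a :: (L.filter fun i => decide (p ω i)) = l})
          ∪ ({ω | p ω a}ᶜ ∩ {ω | (L.filter fun i => decide (p ω i)) = l}) := by
      ext ω
      by_cases h : p ω a <;> simp [h]
    rw [h]
    refine ((hp a).inter ?_).union ((hp a).compl.inter (ih l))
    cases l with
    | nil => simp
    | cons b l =>
      simp only [List.cons.injEq]
      exact (MeasurableSet.const _).inter (ih l)

open Classical in
-- The length of the training sequence is random. The filtered index list takes countably many
-- values, and on each of them the learner sees a fixed list of coordinates.
theorem measurable_learner_filter [MeasurableSpace X] [Countable ι] {A : Learner X}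
    (hAm : MeasurableLearner A) (L : List ι) {R : (ι → Example X) → Set (Example X)}
    (hR : MeasurableSet {q : (ι → Example X) × Example X | q.2 ∈ R q.1}) :
    Measurable fun p : (ι → Example X) × X =>
      A ((L.filter fun i => decide (p.1 i ∈ R p.1)).map p.1) p.2 := by
  apply measurable_to_bool
  have h : (fun p : (ι → Example X) × X =>
      A ((L.filter fun i => decide (p.1 i ∈ R p.1)).map p.1) p.2) ⁻¹' {true}
      = ⋃ l : List ι, ({p | (L.filter fun i => decide (p.1 i ∈ R p.1)) = l}
        ∩ {p | A (l.map p.1) p.2 = true}) := by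
    ext p
    simp
  rw [h]
  refine MeasurableSet.iUnion fun l => MeasurableSet.inter ?_
    (measurable_learner_map hAm l (measurableSet_singleton true))
  refine measurableSet_filter_eq (p := fun (p : (ι → Example X) × X) i => p.1 i ∈ R p.1)
    (fun i => ?_) L l
  have : Measurable fun p : (ι → Example X) × X => (p.1, p.1 i) := by fun_prop
  exact this hR

open Classical in
theorem tieSample_map {t₁ t₂ : ℕ} (v₁ : Fin t₁ → X → Bool) (v₂ : Fin t₂ → X → Bool)
    (L : List ι) (ω : ι → Example X) {R : Set (Example X)}
    (hR : ∀ z, z ∈ R ↔ 11 / 243 ≤ avgNe v₁ z.1 z.2 ∨ 11 / 243 ≤ avgNe v₂ z.1 z.2) :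
    tieSample v₁ v₂ (L.map ω) = (L.filter fun i => decide (ω i ∈ R)).map ω := by
  rw [tieSample, List.filter_map]
  congr 2
  funext i
  simp [hR]

/-- An error of the tie-breaking classifier is an error of the tie-breaker in the region of
disagreement, or an error that a large fraction of both families of voters shares. -/
theorem tie_error_subset {t₁ t₂ : ℕ} (ht₁ : 0 < t₁) (ht₂ : 0 < t₂) (v₁ : Fin t₁ → X → Bool)
    (v₂ : Fin t₂ → X → Bool) (h : X → Bool) :
    {z : Example X | tie v₁ v₂ h z.1 ≠ z.2} ⊆
      {z | (11 / 243 ≤ avgNe v₁ z.1 z.2 ∨ 11 / 243 ≤ avgNe v₂ z.1 z.2) ∧ h z.1 ≠ z.2}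
      ∪ {z | 232 / 243 ≤ avgNe v₁ z.1 z.2 ∧ 232 / 243 ≤ avgNe v₂ z.1 z.2} := by
  rintro ⟨x, y⟩ hz
  simp only [Set.mem_ofPred_eq, Set.mem_union] at hz ⊢
  unfold tie at hz
  -- Treating agreement on the wrong label first makes uniqueness of the agreed label unnecessary.
  -- If neither label is agreed on, some family errs with fraction above 1 - 232/243 = 11/243.
  by_cases hn : BothAgree v₁ v₂ x (!y)
  · right
    rwa [BothAgree, avgEq_not, avgEq_not] at hn
  by_cases hy : BothAgree v₁ v₂ x y
  · exfalso
    cases y <;> simp_all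
  left
  constructor
  · have h1 := avgNe_add_avgEq ht₁ v₁ x y
    have h2 := avgNe_add_avgEq ht₂ v₂ x y
    by_contra! hcon
    exact hy ⟨by linarith [hcon.1], by linarith [hcon.2]⟩
  · cases y <;> simp_all

theorem errorsOn_map (h : X → Bool) (I : List ι) (ω : ι → Example X) :
    errorsOn h (I.map ω) = I.countP fun i => h (ω i).1 != (ω i).2 := by
  rw [errorsOn, List.countP_map]
  rfl

theorem measure_errorsOn_ge_le [MeasurableSpace X] [Fintype ι] (D : Measure (Example X))
    [IsProbabilityMeasure D] {h : X → Bool} (hh : Measurable h) {I : List ι} (hI : I.Nodup)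
    {l κ δ : ℝ} (hl : 0 < l) (hlκ : Real.exp l ≤ 1 + κ * l) (hδ : 0 < δ) :
    (Measure.pi fun _ : ι => D) {ω | κ * (I.length * err D h) + Real.log (1 / δ) / l
      ≤ errorsOn h (I.map ω)} ≤ ENNReal.ofReal δ := by
  classical
  have hE : MeasurableSet {z : Example X | h z.1 ≠ z.2} :=
    (measurableSet_eq_fun (hh.comp measurable_fst) measurable_snd).compl
  have hmain := measure_countP_ge_le D hE hI hl hlκ hδ
  refine (measure_mono fun ω hω => ?_).trans hmain
  rw [Set.mem_ofPred_eq, errorsOn_map] at hω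
  refine le_trans hω (le_of_eq ?_)
  congr 1
  refine List.countP_congr fun i _ => ?_
  simp

theorem exists_block_of_mem_splitting {k : ℕ} {S l : List ι} (hl : l ∈ splitting (k + 6) S []) :
    ∃ b : Fin 27, ((block S b (3 ^ (k + 3))).drop (3 ^ k)).Sublist l
      ∧ l.Sublist (block S b (3 ^ (k + 3))) := by
  simp only [splitting, List.mem_flatMap, List.mem_range] at hl
  obtain ⟨i, hi, hl⟩ := hl
  refine ⟨⟨i, hi⟩, ?_, ?_⟩
  · simpa using (suffix_of_mem_splitting hl).sublist
  · simpa using sublist_of_mem_splitting hl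

end TieBreaking

/-! ### Numerical constants of the final bound. -/

section Arithmetic

/-- The multiplicative loss is to be only κ = 1 + 1/10000. The criterion l(1 + κ²) ≤ κ - 1 then
forces l below roughly 1/20000. -/
theorem exp_small_add_le :
    Real.exp (1 / 30000) + Real.exp (-(10001 / 10000 * (1 / 30000))) ≤ 2 := by
  have h1 := exp_le_one_add_add_sq (x := 1 / 30000) (by norm_num [abs_of_pos])
  have h2 := exp_le_one_add_add_sq (x := -(10001 / 10000 * (1 / 30000)))
    (by norm_num [abs_of_neg])
  norm_num at h1 h2 ⊢
  linarith

theorem exp_small_le : Real.exp (1 / 30000) ≤ 1 + 10001 / 10000 * (1 / 30000) := by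
  have h1 := exp_le_one_add_add_sq (x := 1 / 30000) (by norm_num [abs_of_pos])
  norm_num at h1 ⊢
  linarith

theorem log_ten_pow_le : Real.log (1 / (1 / 10 ^ 18)) ≤ 42 := by
  calc Real.log (1 / (1 / 10 ^ 18)) ≤ Real.log (2 ^ 60) :=
        Real.log_le_log (by norm_num) (by norm_num)
    _ = 60 * Real.log 2 := by rw [Real.log_pow]; norm_num
    _ ≤ 42 := by linarith [Real.log_two_lt_d9]

theorem log_thirtySix_le : Real.log 36 ≤ 5 := by
  calc Real.log 36 ≤ Real.log (2 ^ 6) := Real.log_le_log (by norm_num) (by norm_num)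
    _ = 6 * Real.log 2 := by rw [Real.log_pow]; norm_num
    _ ≤ 5 := by linarith [Real.log_two_lt_d9]

theorem log_eightySix_le : Real.log 86 ≤ 5 := by
  calc Real.log 86 ≤ Real.log (2 ^ 7) := Real.log_le_log (by norm_num) (by norm_num)
    _ = 7 * Real.log 2 := by rw [Real.log_pow]; norm_num
    _ ≤ 5 := by linarith [Real.log_two_lt_d9]

/-- Combining the deviation bounds; all masses are multiplied by the sample-size unit `a`. -/
theorem combine_bounds {a τ d ℓ l₁ N₁ N₂ N₃ NB H₁ H₂ Q₁ Q₂ W W₂ T S : ℝ}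
    (hτ : 0 ≤ a * τ) (hd : 0 ≤ d) (hℓ : 1 ≤ ℓ) (hl₁ : l₁ ≤ 4 + ℓ)
    (hNB : NB ≤ 10001 / 10000 * (27 * (a * τ)) + l₁ / (1 / 30000))
    (hN₁ : N₁ ≤ 10001 / 10000 * (729 * (a * τ)) + l₁ / (1 / 30000))
    (hN₂ : N₂ ≤ 10001 / 10000 * (729 * (a * τ)) + l₁ / (1 / 30000))
    (hN₃ : N₃ ≤ 10001 / 10000 * (729 * (a * τ)) + l₁ / (1 / 30000))
    (hH₁ : 729 * H₁ ≤ 10 ^ 8 * (N₁ + d + (1 + l₁)))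
    (hH₂ : 729 * H₂ ≤ 10 ^ 8 * (N₂ + d + (1 + l₁)))
    (hQ₁ : Q₁ ≤ d + ℓ) (hQ₂ : Q₂ ≤ d + ℓ) (hW : W ≤ H₁ + H₂ + Q₁ + Q₂) (hW₂ : W₂ ≤ W)
    (hT : 729 * T ≤ 10001 / 10000 * N₃ + (2 * (1 / 10 ^ 18) * (729 * W) + d * 42 + l₁) / (1 / 30000))
    (hS : 26 * S ≤ 10001 / 10000 * NB + (2 * (1 / 10 ^ 18) * (26 * W₂) + d * 42 + l₁) / (1 / 30000)) :
    2187 * (T + 243 / 232 * S) ≤ 2.0888 * (2187 * (a * τ)) + 5 * 10 ^ 8 * (d + ℓ) := by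
  -- The coefficient of τ is essentially 1 + (243/232)(27/26) ≈ 2.0877 times κ². The region terms
  -- carry 2 · 10^(-18) · 30000 against masses of order 10^8 aτ and fit in the remaining slack.
  rw [div_div_eq_mul_div, div_one] at hNB hN₁ hN₂ hN₃ hT hS
  norm_num at *
  linarith

end Arithmetic

/-! ### Error bounds for the tie-breaker and for the voters. -/

section Regions

variable {X : Type*} {ι : Type*}

/-- The examples on which at least a fraction `θ` of the sampled voters errs. -/
def votersRegion (A : Learner X) (K : ℕ) (S : List (Example X)) {t : ℕ}
    (i : Fin t → Fin (27 ^ (K / 6))) (θ : ℝ) : Set (Example X) :=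
  {z | θ ≤ avgNe (voters A K S i) z.1 z.2}

/-- The examples on which at least one of the two families of voters has an error fraction of at
least `11 / 243`. -/
def tieRegion (A : Learner X) (K : ℕ) (S₁ S₂ : List (Example X)) {t₁ t₂ : ℕ}
    (i : (Fin t₁ → Fin (27 ^ (K / 6))) × (Fin t₂ → Fin (27 ^ (K / 6)))) : Set (Example X) :=
  votersRegion A K S₁ i.1 (11 / 243) ∪ votersRegion A K S₂ i.2 (11 / 243)

open Classical in
/-- The classifier trained on the part of the sample that lies in the region `R`. -/
noncomputable def trainedOn (A : Learner X) (L : List ι) (R : Set (Example X))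
    (ω : ι → Example X) : X → Bool :=
  A ((L.filter fun a => decide (ω a ∈ R)).map ω)

theorem trainedOn_tieRegion (A : Learner X) (K : ℕ) (L : List ι) (S₁ S₂ : List (Example X))
    {t₁ t₂ : ℕ} (i : (Fin t₁ → Fin (27 ^ (K / 6))) × (Fin t₂ → Fin (27 ^ (K / 6))))
    (ω : ι → Example X) :
    A (tieSample (voters A K S₁ i.1) (voters A K S₂ i.2) (L.map ω))
      = trainedOn A L (tieRegion A K S₁ S₂ i) ω := by
  rw [trainedOn, tieSample_map _ _ L ω (R := tieRegion A K S₁ S₂ i) (fun z => Iff.rfl)]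

theorem measureReal_tieRegion_le [MeasurableSpace X] (D : Measure (Example X))
    [IsProbabilityMeasure D] (A : Learner X) (K : ℕ) (S₁ S₂ : List (Example X)) {t₁ t₂ : ℕ}
    (i : (Fin t₁ → Fin (27 ^ (K / 6))) × (Fin t₂ → Fin (27 ^ (K / 6)))) (T₁ T₂ : Set (Example X)) :
    D.real (tieRegion A K S₁ S₂ i) ≤ D.real T₁ + D.real T₂
      + D.real (votersRegion A K S₁ i.1 (11 / 243) \ T₁)
      + D.real (votersRegion A K S₂ i.2 (11 / 243) \ T₂) := by
  have h : ∀ V T : Set (Example X), D.real V ≤ D.real T + D.real (V \ T) := by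
    intro V T
    refine (measureReal_mono fun z hz => ?_).trans (measureReal_union_le _ _)
    by_cases hT : z ∈ T
    · exact Or.inl hT
    · exact Or.inr ⟨hz, hT⟩
  have e0 : D.real (tieRegion A K S₁ S₂ i) ≤ _ := measureReal_union_le _ _
  have e1 := h (votersRegion A K S₁ i.1 (11 / 243)) T₁
  have e2 := h (votersRegion A K S₂ i.2 (11 / 243)) T₂
  linarith

theorem votersRegion_subset_tieRegion (A : Learner X) (K : ℕ) (S₁ S₂ : List (Example X))
    {t₁ t₂ : ℕ} (i : (Fin t₁ → Fin (27 ^ (K / 6))) × (Fin t₂ → Fin (27 ^ (K / 6)))) :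
    votersRegion A K S₂ i.2 (232 / 243) ⊆ tieRegion A K S₁ S₂ i := by
  intro z hz
  have hz' : 232 / 243 ≤ avgNe (voters A K S₂ i.2) z.1 z.2 := hz
  have h : 11 / 243 ≤ avgNe (voters A K S₂ i.2) z.1 z.2 := by linarith
  exact Or.inr h

variable [MeasurableSpace X]

theorem measurableSet_votersRegion {A : Learner X} (hAm : MeasurableLearner A) (K : ℕ)
    (S : List ι) {t : ℕ} (i : Fin t → Fin (27 ^ (K / 6))) (θ : ℝ) :
    MeasurableSet {q : (ι → Example X) × Example X | q.2 ∈ votersRegion A K (S.map q.1) i θ} :=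
  measurableSet_le measurable_const (measurable_avgNe_voters hAm K S i)

theorem measurableSet_tieRegion {A : Learner X} (hAm : MeasurableLearner A) (K : ℕ)
    (S₁ S₂ : List ι) {t₁ t₂ : ℕ}
    (i : (Fin t₁ → Fin (27 ^ (K / 6))) × (Fin t₂ → Fin (27 ^ (K / 6)))) :
    MeasurableSet {q : (ι → Example X) × Example X |
      q.2 ∈ tieRegion A K (S₁.map q.1) (S₂.map q.1) i} :=
  (measurableSet_votersRegion hAm K S₁ i.1 _).union (measurableSet_votersRegion hAm K S₂ i.2 _)

/-- Decomposition of the error of the tie-breaking classifier. -/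
theorem err_tie_le (D : Measure (Example X)) [IsProbabilityMeasure D] {A : Learner X} {K : ℕ}
    {S₁ S₂ : List (Example X)} {t₁ t₂ : ℕ} (ht₁ : 0 < t₁) (ht₂ : 0 < t₂)
    (i : (Fin t₁ → Fin (27 ^ (K / 6))) × (Fin t₂ → Fin (27 ^ (K / 6)))) (g : X → Bool)
    (hm : ∀ j, MeasurableSet {z | z ∈ votersRegion A K S₂ i.2 (232 / 243)
      ∧ A (leaf K S₁ [] (i.1 j)) z.1 ≠ z.2}) :
    err D (tie (voters A K S₁ i.1) (voters A K S₂ i.2) g)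
      ≤ D.real {z | z ∈ tieRegion A K S₁ S₂ i ∧ g z.1 ≠ z.2}
        + 243 / 232 * ((∑ j, D.real {z | z ∈ votersRegion A K S₂ i.2 (232 / 243)
          ∧ A (leaf K S₁ [] (i.1 j)) z.1 ≠ z.2}) / t₁) := by
  have ht₁' : (0 : ℝ) < t₁ := by exact_mod_cast ht₁
  have hsub := tie_error_subset ht₁ ht₂ (voters A K S₁ i.1) (voters A K S₂ i.2) g
  refine (measureReal_mono hsub).trans ((measureReal_union_le _ _).trans ?_)
  refine add_le_add le_rfl ?_
  have hcov := measureReal_le_sum_of_cover D (Finset.univ : Finset (Fin t₁))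
    (B := fun j => {z | z ∈ votersRegion A K S₂ i.2 (232 / 243)
      ∧ A (leaf K S₁ [] (i.1 j)) z.1 ≠ z.2}) (fun j _ => hm j)
    -- A point of the shared-error set is missed by at least 232t₁/243 voters of the first family,
    -- so these weights cover it.
    (w := fun _ => 243 / (232 * t₁)) (fun _ _ => by positivity)
    (E := {z | 232 / 243 ≤ avgNe (voters A K S₁ i.1) z.1 z.2
      ∧ 232 / 243 ≤ avgNe (voters A K S₂ i.2) z.1 z.2})
    (fun z hz => by
      have hz2 : z ∈ votersRegion A K S₂ i.2 (232 / 243) := hz.2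
      have hz1 := hz.1
      rw [avgNe_eq_sum, le_div_iff₀ ht₁'] at hz1
      rw [← Finset.mul_sum]
      have : ∑ j : Fin t₁, {z | z ∈ votersRegion A K S₂ i.2 (232 / 243)
          ∧ A (leaf K S₁ [] (i.1 j)) z.1 ≠ z.2}.indicator (1 : Example X → ℝ) z
          = ∑ j, if voters A K S₁ i.1 j z.1 ≠ z.2 then (1 : ℝ) else 0 := by
        refine Finset.sum_congr rfl fun j _ => ?_
        by_cases hj : A (leaf K S₁ [] (i.1 j)) z.1 = z.2
        · rw [Set.indicator_of_notMem fun h => h.2 hj, voters_apply, if_neg (not_not.2 hj)]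
        · have hmem : z ∈ {z | z ∈ votersRegion A K S₂ i.2 (232 / 243)
              ∧ A (leaf K S₁ [] (i.1 j)) z.1 ≠ z.2} := ⟨hz2, hj⟩
          rw [Set.indicator_of_mem hmem, voters_apply, if_pos hj, Pi.one_apply]
      rw [this, div_mul_eq_mul_div, le_div_iff₀ (by positivity)]
      linarith)
  refine hcov.trans (le_of_eq ?_)
  rw [← Finset.mul_sum]
  field_simp

/-- High-probability bound for the mass gained by sampling the voters. -/
theorem measure_sampling_ge_le [Fintype ι] {A : Learner X} (hAm : MeasurableLearner A)
    (D : Measure (Example X)) [IsProbabilityMeasure D] (K : ℕ) (L : List ι) {t : ℕ} {J : Type*}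
    [MeasurableSpace J] [Countable J] [MeasurableSingletonClass J] (ν : Measure J)
    [IsProbabilityMeasure ν] {f : J → Fin t → Fin (27 ^ (K / 6))}
    (hf : MeasurePreserving f ν (draws K t)) {ε δ : ℝ} (hε : 0 < ε) (hδ : 0 < δ)
    (hεt : Real.exp (-(t / 9720)) ≤ ε) :
    ((Measure.pi fun _ : ι => D).prod ν) {p | ε / δ ≤
      D.real (votersRegion A K (L.map p.1) (f p.2) (11 / 243)
        \ hardRegion A K (L.map p.1) [])} ≤ ENNReal.ofReal δ := by
  have hs : MeasurableSet {q : ((ι → Example X) × J) × Example X |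
      q.2 ∈ votersRegion A K (L.map q.1.1) (f q.1.2) (11 / 243)
        \ hardRegion A K (L.map q.1.1) []} := by
    have h : {q : ((ι → Example X) × J) × Example X |
      q.2 ∈ votersRegion A K (L.map q.1.1) (f q.1.2) (11 / 243)
        \ hardRegion A K (L.map q.1.1) []} = ⋃ j : J, ({q | q.1.2 = j} ∩
          {q | q.2 ∈ votersRegion A K (L.map q.1.1) (f j) (11 / 243)
            \ hardRegion A K (L.map q.1.1) []}) := by
      ext q
      simp
    rw [h]
    have hm : Measurable fun q : ((ι → Example X) × J) × Example X => (q.1.1, q.2) := by fun_prop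
    refine MeasurableSet.iUnion fun j => MeasurableSet.inter ?_ (hm
      ((measurableSet_votersRegion hAm K L (f j) (11 / 243)).diff
        (measurableSet_hardRegion hAm K L [])))
    exact (measurable_snd.comp measurable_fst) (measurableSet_singleton j)
  refine prod_measure_fiber_ge_le (Measure.pi fun _ : ι => D) ν D hs hε hδ fun ω z => ?_
  refine le_trans ?_ (ENNReal.ofReal_le_ofReal hεt)
  by_cases hz : z ∈ hardRegion A K (L.map ω) []
  · simp [hz]
  · refine le_trans ?_ (draws_avgNe_ge_le A K t (L.map ω) hz)
    rw [← hf.measure_preimage (Set.toFinite _).measurableSet.nullMeasurableSet]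
    exact measure_mono fun j hj => hj.1

/-- The tie-breaker, on the region where it is trained, is almost as good as any competitor. -/
theorem measure_tieBreaker_ge_le [Fintype ι] {H : Set (X → Bool)} {d : ℕ}
    (hd : ∀ C : Finset X, Shatters H C → C.card ≤ d)
    {A : Learner X} (hA : IsERM H A) (hAm : MeasurableLearner A) (D : Measure (Example X))
    [IsProbabilityMeasure D] {h₀ : X → Bool} (hh₀ : h₀ ∈ H) (K : ℕ) {L₁ L₂ L₃ : List ι}
    (hn₃ : L₃.Nodup) (h₁₃ : List.Disjoint L₁ L₃) (h₂₃ : List.Disjoint L₂ L₃)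
    {t₁ t₂ : ℕ} (i : (Fin t₁ → Fin (27 ^ (K / 6))) × (Fin t₂ → Fin (27 ^ (K / 6))))
    {l κ η δ : ℝ} (hl : 0 < l) (hκ : 1 ≤ κ)
    (hlκ : Real.exp l + Real.exp (-(κ * l)) ≤ 2) (hη : 0 < η) (hη1 : η ≤ 1) (hδ : 0 < δ) :
    (Measure.pi fun _ : ι => D) {ω | κ * errorsOn h₀ (L₃.map ω)
      + (2 * η * L₃.length * D.real (tieRegion A K (L₁.map ω) (L₂.map ω) i)
        + d * Real.log (1 / η) + Real.log (1 / δ)) / l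
      ≤ L₃.length * D.real {z | z ∈ tieRegion A K (L₁.map ω) (L₂.map ω) i
        ∧ trainedOn A L₃ (tieRegion A K (L₁.map ω) (L₂.map ω) i) ω z.1 ≠ z.2}}
      ≤ ENNReal.ofReal δ := by
  classical
  have hmain := measure_avgErr_ge_le_of_countP_le hd D (ρ := Unit)
    (g := fun _ ω => trainedOn A L₃ (tieRegion A K (L₁.map ω) (L₂.map ω) i) ω)
    (fun _ => measurable_learner_filter hAm L₃
      (R := fun ω => tieRegion A K (L₁.map ω) (L₂.map ω) i) (measurableSet_tieRegion hAm K L₁ L₂ i))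
    (fun _ ω => (hA _).1) (I := fun _ => L₃) (fun _ => hn₃) (fun _ => rfl)
    (R := fun ω => tieRegion A K (L₁.map ω) (L₂.map ω) i)
    (measurableSet_tieRegion hAm K L₁ L₂ i) (fun _ ω ω' hω => by
      rw [List.map_congr_left fun a ha => hω a fun h => h₁₃ ha h,
        List.map_congr_left fun a ha => hω a fun h => h₂₃ ha h])
    (N := fun ω => errorsOn h₀ (L₃.map ω)) (fun _ ω => by
      -- Errors on the third part inside the region are exactly the errors on the tie-breaker's own
      -- training sequence, which it minimizes.
      calc _ = errorsOn (trainedOn A L₃ (tieRegion A K (L₁.map ω) (L₂.map ω) i) ω)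
            ((L₃.filter fun a => decide (ω a ∈ tieRegion A K (L₁.map ω) (L₂.map ω) i)).map ω) := by
            rw [errorsOn_map, List.countP_filter]
            refine List.countP_congr fun a _ => ?_
            simp [and_comm]
        _ ≤ errorsOn h₀
            ((L₃.filter fun a => decide (ω a ∈ tieRegion A K (L₁.map ω) (L₂.map ω) i)).map ω) :=
            hA.errorsOn_le _ hh₀
        _ ≤ errorsOn h₀ (L₃.map ω) := errorsOn_mono _ (List.filter_sublist.map ω))
    hl hκ hlκ hη hη1 hδ
  simpa using hmain

/-- The largest number of errors of `h` on one of the `27` blocks. -/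
def blockErrors (h : X → Bool) (k : ℕ) (L : List ι) (ω : ι → Example X) : ℕ :=
  Finset.univ.sup fun b : Fin 27 => errorsOn h ((block L b (3 ^ (k + 3))).map ω)

/-- The voters of the first family, on a region determined by the second family, are almost as
good as any competitor. -/
theorem measure_voters_ge_le [Fintype ι] {H : Set (X → Bool)} {d : ℕ}
    (hd : ∀ C : Finset X, Shatters H C → C.card ≤ d)
    {A : Learner X} (hA : IsERM H A) (hAm : MeasurableLearner A) (D : Measure (Example X))
    [IsProbabilityMeasure D] {h₀ : X → Bool} (hh₀ : h₀ ∈ H) (k : ℕ) {L₁ L₂ : List ι}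
    (hL₁ : L₁.length = 3 ^ (k + 6)) (hn₁ : L₁.Nodup) (h₁₂ : List.Disjoint L₁ L₂)
    {t₁ t₂ : ℕ} (ht₁ : 0 < t₁)
    (i : (Fin t₁ → Fin (27 ^ ((k + 6) / 6))) × (Fin t₂ → Fin (27 ^ ((k + 6) / 6))))
    {l κ η δ : ℝ} (hl : 0 < l) (hκ : 1 ≤ κ)
    (hlκ : Real.exp l + Real.exp (-(κ * l)) ≤ 2) (hη : 0 < η) (hη1 : η ≤ 1) (hδ : 0 < δ) :
    (Measure.pi fun _ : ι => D) {ω | κ * blockErrors h₀ k L₁ ω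
      + (2 * η * ((26 * 3 ^ k : ℕ) : ℝ)
          * D.real (votersRegion A (k + 6) (L₂.map ω) i.2 (232 / 243))
        + d * Real.log (1 / η) + Real.log (1 / δ)) / l
      ≤ ((26 * 3 ^ k : ℕ) : ℝ) * ((∑ j, D.real
        {z | z ∈ votersRegion A (k + 6) (L₂.map ω) i.2 (232 / 243)
          ∧ A (leaf (k + 6) (L₁.map ω) [] (i.1 j)) z.1 ≠ z.2}) / t₁)}
      ≤ ENNReal.ofReal δ := by
  -- Each voter lives on one block: it contains the last 26 · 3^k entries and at most all 27 · 3^k.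
  -- Counting the competitor's errors only on that block gives the factor 27/26.
  have hb := fun r => exists_block_of_mem_splitting (leaf_mem (k + 6) L₁ [] r)
  choose b hb1 hb2 using hb
  have : Nonempty (Fin t₁) := ⟨⟨0, ht₁⟩⟩
  have hBlen : ∀ b : Fin 27, (block L₁ b (3 ^ (k + 3))).length = 3 ^ (k + 3) := fun b =>
    length_block (q := 27) (by rw [hL₁]; ring) b.2
  have hVsub : ∀ b : Fin 27, ((block L₁ b (3 ^ (k + 3))).drop (3 ^ k)).Sublist L₁ := fun b =>
    (List.drop_sublist _ _).trans (block_sublist _ _ _)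
  have hmain := measure_avgErr_ge_le hd hA hAm D hh₀ (ρ := Fin t₁)
    (lf := fun j => leaf (k + 6) L₁ [] (i.1 j))
    (I := fun j => (block L₁ (b (i.1 j)) (3 ^ (k + 3))).drop (3 ^ k)) (n := 26 * 3 ^ k)
    (fun j => (hVsub _).nodup hn₁)
    (fun j => by
      rw [List.length_drop, hBlen, pow_add]
      omega)
    (fun j => hb1 (i.1 j))
    (R := fun ω => votersRegion A (k + 6) (L₂.map ω) i.2 (232 / 243))
    (measurableSet_votersRegion hAm (k + 6) L₂ i.2 (232 / 243))
    (fun j ω ω' hω => by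
      rw [List.map_congr_left fun a ha => hω a fun h => h₁₂ ((hVsub _).subset h) ha])
    (N := blockErrors h₀ k L₁) (fun j ω => (errorsOn_mono _ ((hb2 (i.1 j)).map ω)).trans
      (Finset.le_sup (f := fun b : Fin 27 => errorsOn h₀ ((block L₁ b (3 ^ (k + 3))).map ω))
        (Finset.mem_univ _)))
    hl hκ hlκ hη hη1 hδ
  have hleaf : ∀ (ω : ι → Example X) (j : Fin t₁),
      (leaf (k + 6) L₁ [] (i.1 j)).map ω = leaf (k + 6) (L₁.map ω) [] (i.1 j) := fun ω j => by
    rw [← leaf_map, List.map_nil]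
  simpa only [hleaf, Fintype.card_fin] using hmain

end Regions

/-! ### Union of all events and the combined estimate. -/

section Main

variable {X : Type*} [MeasurableSpace X] {ι : Type*}

/-- The main estimate, for a competitor `h₀` and three disjoint parts of the sample. -/
theorem measure_tie_gt_le [Fintype ι] {H : Set (X → Bool)} {d : ℕ}
    (hd : ∀ C : Finset X, Shatters H C → C.card ≤ d) (hH : ∀ h ∈ H, Measurable h)
    {A : Learner X} (hA : IsERM H A) (hAm : MeasurableLearner A) (D : Measure (Example X))
    [IsProbabilityMeasure D] {h₀ : X → Bool} (hh₀ : h₀ ∈ H) (k : ℕ) {L₁ L₂ L₃ : List ι}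
    (hL₁ : L₁.length = 3 ^ (k + 6)) (hL₂ : L₂.length = 3 ^ (k + 6))
    (hL₃ : L₃.length = 3 ^ (k + 6)) (hn₁ : L₁.Nodup) (hn₂ : L₂.Nodup) (hn₃ : L₃.Nodup)
    (h₁₂ : List.Disjoint L₁ L₂) (h₁₃ : List.Disjoint L₁ L₃) (h₂₃ : List.Disjoint L₂ L₃)
    {t₁ t₂ : ℕ} (ht₁ : 0 < t₁) (ht₂ : 0 < t₂) {δ ε : ℝ} (hδ : 0 < δ) (hδ1 : δ ≤ 1) (hε : 0 < ε)
    (hεt₁ : Real.exp (-(t₁ / 9720)) ≤ ε) (hεt₂ : Real.exp (-(t₂ / 9720)) ≤ ε)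
    (hεδ : 3 ^ k * (ε / (δ / 36)) ≤ d + (1 + Real.log (1 / δ))) :
    ((Measure.pi fun _ : ι => D).prod ((draws (k + 6) t₁).prod (draws (k + 6) t₂)))
      {p | 2.0888 * (2187 * (3 ^ k * err D h₀)) + 5 * 10 ^ 8 * (d + (1 + Real.log (1 / δ)))
        < 2187 * (3 ^ k * err D (tie (voters A (k + 6) (L₁.map p.1) p.2.1)
          (voters A (k + 6) (L₂.map p.1) p.2.2)
          (A (tieSample (voters A (k + 6) (L₁.map p.1) p.2.1)
            (voters A (k + 6) (L₂.map p.1) p.2.2) (L₃.map p.1)))))} ≤ ENNReal.ofReal δ := by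
  have hδ₁ : 0 < δ / 36 := by positivity
  have hmh₀ := hH h₀ hh₀
  have bN := fun (I : List ι) (hI : I.Nodup) => measure_errorsOn_ge_le D hmh₀ hI
    (l := 1 / 30000) (by norm_num) exp_small_le hδ₁
  have bC := fun (I : List ι) (hI : I.Nodup) (hlen : I.length = 3 ^ (k + 6)) =>
    measure_hardRegion_gt_le hd hA hAm D hh₀ (k + 6) I [] hlen
      (by rwa [List.append_nil]) (δ / 36) hδ₁ (by linarith)
  have bT := fun i : (Fin t₁ → Fin (27 ^ ((k + 6) / 6))) × (Fin t₂ → Fin (27 ^ ((k + 6) / 6))) =>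
    measure_tieBreaker_ge_le hd hA hAm D hh₀ (k + 6) hn₃ h₁₃ h₂₃ i (l := 1 / 30000)
      (κ := 10001 / 10000) (η := 1 / 10 ^ 18) (by norm_num) (by norm_num) exp_small_add_le
      (by norm_num) (by norm_num) hδ₁
  have bP := fun i : (Fin t₁ → Fin (27 ^ ((k + 6) / 6))) × (Fin t₂ → Fin (27 ^ ((k + 6) / 6))) =>
    measure_voters_ge_le hd hA hAm D hh₀ k hL₁ hn₁ h₁₂ ht₁ i (l := 1 / 30000)
      (κ := 10001 / 10000) (η := 1 / 10 ^ 18) (by norm_num) (by norm_num) exp_small_add_le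
      (by norm_num) (by norm_num) hδ₁
  have bG₁ := measure_sampling_ge_le hAm D (k + 6) L₁
    ((draws (k + 6) t₁).prod (draws (k + 6) t₂)) (f := Prod.fst) measurePreserving_fst hε hδ₁ hεt₁
  have bG₂ := measure_sampling_ge_le hAm D (k + 6) L₂
    ((draws (k + 6) t₁).prod (draws (k + 6) t₂)) (f := Prod.snd) measurePreserving_snd hε hδ₁ hεt₂
  have bB := fun b : Fin 27 =>
    bN (block L₁ b (3 ^ (k + 3))) ((block_sublist _ _ _).nodup hn₁)
  generalize hμ : (Measure.pi fun _ : ι => D) = μ at *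
  generalize hν : (draws (k + 6) t₁).prod (draws (k + 6) t₂) = ν at *
  have : IsProbabilityMeasure μ := by rw [← hμ]; infer_instance
  have : IsProbabilityMeasure ν := by rw [← hν]; infer_instance
  have bB' := fun b => prod_measure_le_of_forall μ ν (B := fun _ => _) fun _ => bB b
  have b1 := prod_measure_le_of_forall μ ν (B := fun _ => _) fun _ => bN L₁ hn₁
  have b2 := prod_measure_le_of_forall μ ν (B := fun _ => _) fun _ => bN L₂ hn₂
  have b3 := prod_measure_le_of_forall μ ν (B := fun _ => _) fun _ => bN L₃ hn₃
  have b4 := prod_measure_le_of_forall μ ν (B := fun _ => _) fun _ => bC L₁ hn₁ hL₁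
  have b5 := prod_measure_le_of_forall μ ν (B := fun _ => _) fun _ => bC L₂ hn₂ hL₂
  have b6 := prod_measure_le_of_forall μ ν bT
  have b7 := prod_measure_le_of_forall μ ν bP
  have hunion := (measure_union_le _ _).trans (add_le_add
    ((measure_iUnion_fintype_le (μ.prod ν) _).trans (Finset.sum_le_sum fun b _ => bB' b))
    ((measure_union_le _ _).trans (add_le_add b1
      ((measure_union_le _ _).trans (add_le_add b2
        ((measure_union_le _ _).trans (add_le_add b3
          ((measure_union_le _ _).trans (add_le_add b4
            ((measure_union_le _ _).trans (add_le_add b5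
              ((measure_union_le _ _).trans (add_le_add b6
                ((measure_union_le _ _).trans (add_le_add b7
                  ((measure_union_le _ _).trans (add_le_add bG₁ bG₂)))))))))))))))))
  -- There are 27 block events and 9 others, hence the division by 36.
  have hsum : (∑ _b : Fin 27, ENNReal.ofReal (δ / 36)) + (ENNReal.ofReal (δ / 36)
      + (ENNReal.ofReal (δ / 36) + (ENNReal.ofReal (δ / 36) + (ENNReal.ofReal (δ / 36)
      + (ENNReal.ofReal (δ / 36) + (ENNReal.ofReal (δ / 36) + (ENNReal.ofReal (δ / 36)
      + (ENNReal.ofReal (δ / 36) + ENNReal.ofReal (δ / 36)))))))))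
      = ENNReal.ofReal δ := by
    have h36 : ENNReal.ofReal δ = 36 * ENNReal.ofReal (δ / 36) := by
      rw [← ENNReal.ofReal_ofNat 36, ← ENNReal.ofReal_mul (by norm_num)]
      congr 1
      ring
    rw [h36, Finset.sum_const, Finset.card_univ, Fintype.card_fin, nsmul_eq_mul]
    push_cast
    ring
  rw [hsum] at hunion
  refine (measure_mono fun p hp => ?_).trans hunion
  by_contra hcon
  simp only [Set.mem_union, Set.mem_iUnion, not_or, not_exists, Set.mem_ofPred_eq] at hcon
  obtain ⟨cB, c0, c1, c2, c3, c4, c5, c6, c7, c8⟩ := hcon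
  obtain ⟨ω, i⟩ := p
  revert hp
  simp only [Set.mem_ofPred_eq, imp_false, not_lt]
  simp only [not_le, not_lt, hL₁, hL₂, hL₃, List.append_nil, List.map_nil]
    at cB c0 c1 c2 c3 c4 c5 c6 c7 c8
  set a : ℝ := 3 ^ k with ha
  have ha0 : 0 < a := by positivity
  have hpow : (3 : ℝ) ^ (k + 6) = 729 * a := by rw [pow_add, ha]; ring
  have hcast : ((3 ^ (k + 6) : ℕ) : ℝ) = 729 * a := by push_cast; exact hpow
  have hcast2 : ((26 * 3 ^ k : ℕ) : ℝ) = 26 * a := by push_cast; rfl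
  rw [hcast] at c0 c1 c2 c5
  rw [hcast2] at c6
  rw [hpow] at c3 c4
  rw [trainedOn_tieRegion A (k + 6) L₃ (L₁.map ω) (L₂.map ω) i]
  have hm : ∀ j, MeasurableSet {z | z ∈ votersRegion A (k + 6) (L₂.map ω) i.2 (232 / 243)
      ∧ A (leaf (k + 6) (L₁.map ω) [] (i.1 j)) z.1 ≠ z.2} := fun j => by
    have h := measurableSet_errors (R := fun ω => votersRegion A (k + 6) (L₂.map ω) i.2 (232 / 243))
      (measurableSet_votersRegion hAm (k + 6) L₂ i.2 (232 / 243))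
      (g := fun ω => A ((leaf (k + 6) L₁ [] (i.1 j)).map ω)) (measurable_learner_map hAm _)
    have h' := (measurable_const (a := ω)).prodMk measurable_id h
    rw [← List.map_nil (f := ω), leaf_map]
    exact h'
  have herr := err_tie_le D ht₁ ht₂ i
    (trainedOn A L₃ (tieRegion A (k + 6) (L₁.map ω) (L₂.map ω) i) ω) hm
  have hRle := measureReal_tieRegion_le D A (k + 6) (L₁.map ω) (L₂.map ω) i
    (hardRegion A (k + 6) (L₁.map ω) []) (hardRegion A (k + 6) (L₂.map ω) [])
  have hR₂le : D.real (votersRegion A (k + 6) (L₂.map ω) i.2 (232 / 243)) ≤ _ :=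
    measureReal_mono (votersRegion_subset_tieRegion A (k + 6) (L₁.map ω) (L₂.map ω) i)
  have hNBle : (blockErrors h₀ k L₁ ω : ℝ) ≤ 10001 / 10000 * (27 * (a * err D h₀))
      + Real.log (1 / (δ / 36)) / (1 / 30000) := by
    obtain ⟨b, -, hb⟩ := Finset.exists_mem_eq_sup (Finset.univ : Finset (Fin 27))
      Finset.univ_nonempty fun b : Fin 27 => errorsOn h₀ ((block L₁ b (3 ^ (k + 3))).map ω)
    have h1 := cB b
    rw [length_block (q := 27) (by rw [hL₁]; ring) b.2] at h1
    rw [blockErrors, hb]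
    refine h1.le.trans (le_of_eq ?_)
    push_cast
    rw [pow_add, ← ha]
    ring
  have hlog0 : 0 ≤ Real.log (1 / δ) := Real.log_nonneg (by rw [le_div_iff₀ hδ]; linarith)
  have hl₁le : Real.log (1 / (δ / 36)) ≤ 4 + (1 + Real.log (1 / δ)) := by
    rw [log_div_le_of_pos hδ (by norm_num)]
    linarith [log_thirtySix_le]
  have hd0 : (0 : ℝ) ≤ d := Nat.cast_nonneg _
  have h42 := mul_le_mul_of_nonneg_left log_ten_pow_le hd0
  have herr0 : 0 ≤ a * err D h₀ := mul_nonneg ha0.le measureReal_nonneg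
  generalize Real.log (1 / (δ / 36)) = l₁ at *
  generalize D.real (tieRegion A (k + 6) (L₁.map ω) (L₂.map ω) i) = W at *
  generalize D.real (votersRegion A (k + 6) (L₂.map ω) i.2 (232 / 243)) = W₂ at *
  generalize (∑ j, D.real {z | z ∈ votersRegion A (k + 6) (L₂.map ω) i.2 (232 / 243)
    ∧ A (leaf (k + 6) (L₁.map ω) [] (i.1 j)) z.1 ≠ z.2}) / (t₁ : ℝ) = Pp at *
  generalize D.real {z | z ∈ tieRegion A (k + 6) (L₁.map ω) (L₂.map ω) i
    ∧ trainedOn A L₃ (tieRegion A (k + 6) (L₁.map ω) (L₂.map ω) i) ω z.1 ≠ z.2} = Pt at *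
  have hmain := combine_bounds (T := a * Pt) (S := a * Pp) (W := a * W) (W₂ := a * W₂)
    herr0 hd0 (by linarith) hl₁le hNBle
    (c0.le.trans (le_of_eq (by ring))) (c1.le.trans (le_of_eq (by ring)))
    (c2.le.trans (le_of_eq (by ring)))
    (by rw [← mul_assoc]; exact c3) (by rw [← mul_assoc]; exact c4)
    ((mul_le_mul_of_nonneg_left c7.le ha0.le).trans hεδ)
    ((mul_le_mul_of_nonneg_left c8.le ha0.le).trans hεδ)
    (by rw [← mul_add, ← mul_add, ← mul_add]; exact mul_le_mul_of_nonneg_left hRle ha0.le)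
    (mul_le_mul_of_nonneg_left hR₂le ha0.le)
    (by
      rw [← mul_assoc]
      refine c5.le.trans ?_
      rw [mul_assoc (2 * (1 / 10 ^ 18)), mul_assoc 729]
      gcongr)
    (by
      rw [← mul_assoc]
      refine c6.le.trans ?_
      rw [mul_assoc (2 * (1 / 10 ^ 18)), mul_assoc 26]
      gcongr)
  refine le_trans ?_ hmain
  have := mul_le_mul_of_nonneg_left herr ha0.le
  linarith

end Main

/-! ### Logarithms of the confidence parameter. -/

section Constants

theorem log_exp_one_div {δ : ℝ} (hδ : 0 < δ) :
    Real.log (Real.exp 1 / δ) = 1 + Real.log (1 / δ) := by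
  rw [Real.log_div (Real.exp_pos 1).ne' hδ.ne', Real.log_exp, one_div, Real.log_inv]
  ring

theorem log_eightySix_div_le {δ : ℝ} (hδ : 0 < δ) (hδ1 : δ ≤ 1) :
    Real.log (86 / δ) ≤ 5 * (1 + Real.log (1 / δ)) := by
  have h0 : 0 ≤ Real.log (1 / δ) := Real.log_nonneg (by rw [le_div_iff₀ hδ]; linarith)
  have h : Real.log (86 / δ) = Real.log 86 + Real.log (1 / δ) := by
    rw [Real.log_div (by norm_num) hδ.ne', one_div, Real.log_inv]
    ring
  linarith [log_eightySix_le]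

theorem log_eightySix_div_pos {δ : ℝ} (hδ : 0 < δ) (hδ1 : δ ≤ 1) : 0 < Real.log (86 / δ) :=
  Real.log_pos (by rw [lt_div_iff₀ hδ]; linarith)

/-- The number of draws needed for the sampling error `exp (-(t / 9720))` to be at most `x⁻¹`. -/
theorem exp_neg_le_inv_of_log_le {x t : ℝ} (hx : 1 ≤ x)
    (ht : 4 * 243 ^ 2 * Real.log x ≤ t) : Real.exp (-(t / 9720)) ≤ x⁻¹ := by
  have h0 := Real.log_nonneg hx
  rw [← Real.exp_log (inv_pos.2 (zero_lt_one.trans_le hx)), Real.exp_le_exp, Real.log_inv]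
  linarith

end Constants

/-! ### Near-optimal competitors. -/

section Competitor

variable {X : Type*} [MeasurableSpace X]

theorem err_nonneg (D : Measure (Example X)) (h : X → Bool) : 0 ≤ err D h := measureReal_nonneg

theorem err_le_one (D : Measure (Example X)) [IsProbabilityMeasure D] (h : X → Bool) :
    err D h ≤ 1 := measureReal_le_one

theorem bestErr_nonneg (D : Measure (Example X)) (H : Set (X → Bool)) : 0 ≤ bestErr D H :=
  Real.sInf_nonneg (by rintro _ ⟨h, -, rfl⟩; exact err_nonneg D h)

theorem exists_err_lt_bestErr_add (D : Measure (Example X)) {H : Set (X → Bool)}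
    (hH : H.Nonempty) {η : ℝ} (hη : 0 < η) : ∃ h ∈ H, err D h < bestErr D H + η := by
  obtain ⟨_, ⟨h, hh, rfl⟩, hlt⟩ := Real.lt_sInf_add_pos (hH.image (err D)) hη
  exact ⟨h, hh, hlt⟩

end Competitor

/-! ### Consequences of finite VC dimension. -/

section VCDim

variable {X : Type*}

theorem HasVCDim.nonempty {H : Set (X → Bool)} {d : ℕ} (hd : HasVCDim H d) : H.Nonempty := by
  obtain ⟨C, -, hC⟩ := hd.1
  obtain ⟨h, hh, -⟩ := hC fun _ => true
  exact ⟨h, hh⟩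

theorem HasVCDim.card_le {H : Set (X → Bool)} {d : ℕ} (hd : HasVCDim H d) (C : Finset X)
    (hC : Shatters H C) : C.card ≤ d := hd.2 ⟨C, rfl, hC⟩

end VCDim

end TieLearn

open TieLearn in
theorem mainTheorem2 :
    ∃ c : ℝ, 1 ≤ c ∧
      ∀ (X : Type*) [MeasurableSpace X] (H : Set (X → Bool)) (d : ℕ)
        (_hd : TieLearn.HasVCDim H d) (_hH : ∀ h ∈ H, Measurable h)
        (A : TieLearn.Learner X) (_hA : TieLearn.IsERM H A)
        (_hAm : TieLearn.MeasurableLearner A)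
        (D : MeasureTheory.Measure (TieLearn.Example X)) [MeasureTheory.IsProbabilityMeasure D]
        (δ : ℝ) (_hδ0 : 0 < δ) (_hδ1 : δ < 1)
        (m k : ℕ) (_hm : m = 3 ^ k) (_hk : 5 ≤ k) (t₁ t₂ : ℕ)
        (_ht₁ : 4 * 243 ^ 2 * Real.log (2 * m / (δ * (d + Real.log (86 / δ)))) ≤ (t₁ : ℝ))
        (_ht₂ : 4 * 243 ^ 2 * Real.log (2 * m / (δ * (d + Real.log (86 / δ)))) ≤ (t₂ : ℝ)),
        1 - δ ≤
          ((MeasureTheory.Measure.pi fun _ : Fin m => D).prod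
            ((TieLearn.draws (k - 1) t₁).prod (TieLearn.draws (k - 1) t₂))).real
            {ω | TieLearn.err D (TieLearn.tieMajority A k (List.ofFn ω.1) ω.2.1 ω.2.2) ≤
              2.0888 * TieLearn.bestErr D H
                + √(c * TieLearn.bestErr D H * (d + Real.log (Real.exp 1 / δ)) / m)
                + c * (d + Real.log (Real.exp 1 / δ)) / m} := by
  refine ⟨10 ^ 9, by norm_num, ?_⟩
  intro X _ H d hd hH A hA hAm D _ δ hδ0 hδ1 m k hm hk t₁ t₂ ht₁ ht₂
  rw [log_exp_one_div hδ0]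
  have hlog0 : 0 ≤ Real.log (1 / δ) := Real.log_nonneg (by rw [le_div_iff₀ hδ0]; linarith)
  have hd0 : (0 : ℝ) ≤ d := Nat.cast_nonneg _
  have hQ := log_eightySix_div_le hδ0 hδ1.le
  have hQ0 := log_eightySix_div_pos hδ0 hδ1.le
  have hm0 : (0 : ℝ) < m := by rw [hm]; positivity
  have hτ := bestErr_nonneg D H
  -- For such m the claimed bound is at least 1. Otherwise m is so large that k ≥ 7, and the
  -- splitting of each third really recurses.
  by_cases htriv : (m : ℝ) ≤ 10 ^ 9 * (d + (1 + Real.log (1 / δ)))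
  · refine one_sub_le_measureReal _ hδ0.le ?_
    refine (measure_mono_null (Set.compl_empty_iff.2 ?_).subset measure_empty).le.trans zero_le
    refine Set.eq_univ_of_forall fun ω => ?_
    have h1 := err_le_one D (tieMajority A k (List.ofFn ω.1) ω.2.1 ω.2.2)
    have h2 : 1 ≤ 10 ^ 9 * (d + (1 + Real.log (1 / δ))) / m := by
      rwa [le_div_iff₀ hm0, one_mul]
    have h3 := Real.sqrt_nonneg (10 ^ 9 * bestErr D H * (d + (1 + Real.log (1 / δ))) / m)
    simp only [Set.mem_ofPred_eq]
    linarith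
  rw [not_le] at htriv
  have hk7 : 7 ≤ k := by
    by_contra hcon
    have h : m ≤ 3 ^ 6 := by rw [hm]; exact Nat.pow_le_pow_right (by norm_num) (by omega)
    have h' : (m : ℝ) ≤ 729 := by exact_mod_cast h
    linarith
  obtain ⟨k, rfl⟩ : ∃ k', k = k' + 7 := ⟨k - 7, by omega⟩
  set Q : ℝ := d + Real.log (86 / δ) with hQdef
  have hQpos : 0 < Q := by positivity
  have hQle : Q ≤ 5 * (d + (1 + Real.log (1 / δ))) := by linarith
  have hδQ : 0 < δ * Q := by positivity
  -- This makes the required numbers of voters positive, which excludes empty families.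
  have hx : 1 < 2 * m / (δ * Q) := by
    rw [lt_div_iff₀ hδQ]
    nlinarith
  have hlogx := Real.log_pos hx
  have htpos : ∀ t : ℕ, 4 * 243 ^ 2 * Real.log (2 * m / (δ * Q)) ≤ (t : ℝ) → 0 < t := fun t ht => by
    have : (0 : ℝ) < t := lt_of_lt_of_le (by positivity) ht
    exact_mod_cast this
  -- The infimum need not be attained. An excess of 1/m costs 2.0888 after multiplication by m and
  -- is absorbed by the passage from 5 · 10^8 to 10^9.
  obtain ⟨h₀, hh₀, hτh₀⟩ := exists_err_lt_bestErr_add D hd.nonempty (inv_pos.2 hm0)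
  have hma : (m : ℝ) = 2187 * 3 ^ k := by rw [hm]; push_cast; rw [pow_add]; ring
  have hlen : (List.finRange m).length = 3 * 3 ^ (k + 6) := by
    rw [List.length_finRange, hm]; ring
  have hnd := List.nodup_finRange m
  have key := measure_tie_gt_le hd.card_le hH hA hAm D hh₀ k
    (length_block hlen (i := 0) (by norm_num)) (length_block hlen (i := 1) (by norm_num))
    (length_block hlen (i := 2) (by norm_num)) ((block_sublist _ _ _).nodup hnd)
    ((block_sublist _ _ _).nodup hnd) ((block_sublist _ _ _).nodup hnd)
    (disjoint_block hnd (by norm_num) _) (disjoint_block hnd (by norm_num) _)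
    (disjoint_block hnd (by norm_num) _) (htpos t₁ ht₁) (htpos t₂ ht₂) hδ0 hδ1.le
    -- With this ε the sampling mass, scaled by 3^k, is 18Q/2187, which is below d + 1 + log(1/δ)
    -- because Q is at most five times that.
    (ε := (2 * m / (δ * Q))⁻¹) (by positivity) (exp_neg_le_inv_of_log_le hx.le ht₁)
    (exp_neg_le_inv_of_log_le hx.le ht₂) (by
      have : 3 ^ k * ((2 * m / (δ * Q))⁻¹ / (δ / 36)) = 18 / 2187 * Q := by
        rw [hma]; field_simp; norm_num
      rw [this]
      linarith)
  refine one_sub_le_measureReal _ hδ0.le ((measure_mono fun p hp => ?_).trans key)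
  simp only [Set.mem_compl_iff, Set.mem_ofPred_eq, not_le, List.ofFn_eq_map, tieMajority,
    block_map] at hp
  change (_ : ℝ) < _
  have h3 := Real.sqrt_nonneg (10 ^ 9 * bestErr D H * (d + (1 + Real.log (1 / δ))) / m)
  -- The square-root term is discarded: the slack in 2.0888 already does its work.
  have hp' := (add_le_add_left (le_add_of_nonneg_right h3) _).trans_lt hp
  have h4 := mul_lt_mul_of_pos_left hp' hm0
  have h5 := mul_lt_mul_of_pos_left hτh₀ hm0
  rw [mul_add, mul_inv_cancel₀ hm0.ne'] at h5
  rw [mul_add, mul_div_cancel₀ _ hm0.ne'] at h4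
  simp only [← mul_assoc, ← hma]
  refine lt_of_le_of_lt ?_ h4
  linarith
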